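/- **Conventions.** Manifolds are smooth manifolds and $n>3$. A *Finsler space* $(M,L)$ is a manifold $M$ with a function $L(x,y)$ on $TM$ that is smooth and positive for $y\ne 0$, positively homogeneous of degree one in $y$, and whose fundamental tensor $g_{ij}=\frac12\,\partial^2 L^2/\partial y^i\partial y^j$ is positive definite for all $y\neq 0$. A *geodesic* of $(M,L)$ is a smooth regular curve on an open interval, in an arbitrary parametrization, satisfying the Euler–Lagrange equations $\frac{d}{dt}\frac{\partial L}{\partial y^i}(x,\dot x)=\frac{\partial L}{\partial x^i}(x,\dot x)$. A change $L\to L'$ of Finsler metrics on $M$ is *projective* if every geodesic of $(M,L)$ is a geodesic of $(M,L')$ and conversely. A Finsler space is *locally Minkowski* if around every point there are coordinates $(x^i)$, with induced fibre coordinates $(y^i)$, in which its metric depends on $y$ only. A Finsler space $(M,L)$ is *projectively flat* if there is a projective change $L\to L'$ such that $(M,L')$ is a locally Minkowski Finsler space. **Theorem 5.3.** Let $F^n=(M^n,L)$, $n>3$, be a projectively flat Finsler space. Let $f:M^{n-1}\to M^n$ be an immersed hypersurface, that is, $M^{n-1}$ is a manifold of dimension $n-1$ and $f$ is smooth with $df_u$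 of rank $n-1$ at every $u$. Write $F^{n-1}=(M^{n-1},\bar L)$ with the induced metric $\bar L(u,v)=L(f(u),df_u(v))$, and assume that $F^{n-1}$ is totally geodesic: for every geodesic $c$ of $F^{n-1}$, the curve $f\circ c$ is a geodesic of $F^n$. Let $\sigma$ be a smooth function and $\beta=b_i(x)y^i$ a smooth 1-form on $M^n$ such that $$L^*(x,y)=e^{\sigma(x)}L(x,y)+\beta(x,y)$$ is again a Finsler metric on $M^n$ and such that the change $L\to L^*$ is projective (a projective Randers conformal change). Then the hypersurface $F^{*(n-1)}=(M^{n-1},\bar L^*)$ of $F^{*n}=(M^n,L^*)$, where $\bar L^*(u,v)=L^*(f(u),df_u(v))$, is a projectively flat Finsler space. -/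

import Mathlib

open scoped Manifold ContDiff
open Set

noncomputable section

namespace Finsler

section Defs

variable {E : Type*} [NormedAddCommGroup E] [NormedSpace ℝ E]
  {M : Type*} [TopologicalSpace M] [ChartedSpace E M] [IsManifold 𝓘(ℝ, E) ∞ M]

/-- The tensor `g_y(u, v) = ∂²/∂s∂t (L²/2)(x, y + s u + t v)` at `s = t = 0`, that is,
`g_{ij}(x, y) uⁱ vʲ` with `g_{ij} = ∂²(L²/2)/∂yⁱ∂yʲ`. -/
def fundamentalTensor (L : ∀ x : M, TangentSpace 𝓘(ℝ, E) x → ℝ) (x : M)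
    (y u v : TangentSpace 𝓘(ℝ, E) x) : ℝ :=
  deriv (fun s : ℝ => deriv (fun t : ℝ => (L x (y + s • u + t • v)) ^ 2 / 2) 0) 0

/-- `L` is the fundamental function of a Finsler space on `M`: positive and smooth off the zero
section, positively homogeneous of degree one, with positive definite fundamental tensor. -/
structure IsFinsler (L : ∀ x : M, TangentSpace 𝓘(ℝ, E) x → ℝ) : Prop where
  smooth : ContMDiffOn 𝓘(ℝ, E).tangent 𝓘(ℝ, ℝ) ∞
    (fun v : TangentBundle 𝓘(ℝ, E) M => L v.proj v.snd) {v | v.snd ≠ 0}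
  pos : ∀ (x : M) (y : TangentSpace 𝓘(ℝ, E) x), y ≠ 0 → 0 < L x y
  homogeneous : ∀ (x : M) (y : TangentSpace 𝓘(ℝ, E) x) (t : ℝ), 0 < t →
    L x (t • y) = t * L x y
  posDef : ∀ (x : M) (y u : TangentSpace 𝓘(ℝ, E) x), y ≠ 0 → u ≠ 0 →
    0 < fundamentalTensor L x y u u

/-- The function `L(x, y)` written in the coordinates `(xⁱ, yⁱ)` of the chart `e`
(meaningful for `x ∈ e.target`). -/
def coordExpr (L : ∀ x : M, TangentSpace 𝓘(ℝ, E) x → ℝ) (e : OpenPartialHomeomorph M E)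
    (x y : E) : ℝ :=
  L (e.symm x) (mfderiv 𝓘(ℝ, E) 𝓘(ℝ, E) e.symm x y)

/-- The Euler-Lagrange equations `d/dt (∂L/∂yⁱ) = ∂L/∂xⁱ` of `L` along the curve `c`, at the time
`t`, in the coordinates of the chart `e`; the index `i` is replaced by an arbitrary vector `w`. -/
def EulerLagrangeAt (L : ∀ x : M, TangentSpace 𝓘(ℝ, E) x → ℝ) (e : OpenPartialHomeomorph M E)
    (c : ℝ → M) (t : ℝ) : Prop :=
  ∀ w : E,
    deriv (fun s : ℝ => fderiv ℝ (fun y : E => coordExpr L e (e (c s)) y)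
        (deriv (fun r : ℝ => e (c r)) s) w) t =
      fderiv ℝ (fun x : E => coordExpr L e x (deriv (fun r : ℝ => e (c r)) t)) (e (c t)) w

/-- `c`, restricted to the open interval `J`, is a geodesic of `L`, in an arbitrary regular
parametrization: an extremal of the length integral `∫ L(c, c') dt`. -/
structure IsGeodesicOn (L : ∀ x : M, TangentSpace 𝓘(ℝ, E) x → ℝ) (c : ℝ → M) (J : Set ℝ) :
    Prop where
  isOpen : IsOpen J
  ordConnected : J.OrdConnected
  smooth : ContMDiffOn 𝓘(ℝ, ℝ) 𝓘(ℝ, E) ∞ c J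
  regular : ∀ t ∈ J, mfderiv 𝓘(ℝ, ℝ) 𝓘(ℝ, E) c t (1 : ℝ) ≠ 0
  eulerLagrange : ∀ t ∈ J, ∀ e ∈ IsManifold.maximalAtlas 𝓘(ℝ, E) ∞ M, c t ∈ e.source →
    EulerLagrangeAt L e c t

/-- The change `L → L'` is projective: every geodesic of `L` is a geodesic of `L'`, and
conversely. -/
def IsProjectiveChange (L L' : ∀ x : M, TangentSpace 𝓘(ℝ, E) x → ℝ) : Prop :=
  ∀ (c : ℝ → M) (J : Set ℝ), IsGeodesicOn L c J ↔ IsGeodesicOn L' c J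

/-- `(M, L)` is a locally Minkowski space: a Finsler space such that, around every point, there
are coordinates in which `L` depends on `y` only. -/
def IsLocallyMinkowski (L : ∀ x : M, TangentSpace 𝓘(ℝ, E) x → ℝ) : Prop :=
  IsFinsler L ∧ ∀ p : M, ∃ e ∈ IsManifold.maximalAtlas 𝓘(ℝ, E) ∞ M, p ∈ e.source ∧
    ∀ x ∈ e.target, ∀ x' ∈ e.target, ∀ y : E, coordExpr L e x y = coordExpr L e x' y

/-- `(M, L)` is a projectively flat Finsler space: some projective change `L → L'` of it leads to
a locally Minkowski space `(M, L')`. -/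
def IsProjectivelyFlat (L : ∀ x : M, TangentSpace 𝓘(ℝ, E) x → ℝ) : Prop :=
  IsFinsler L ∧ ∃ L' : ∀ x : M, TangentSpace 𝓘(ℝ, E) x → ℝ,
    IsLocallyMinkowski L' ∧ IsProjectiveChange L L'

/-- The Randers conformal change `L* = e^σ L + β` of `L`. -/
def randersConformalChange (σ : M → ℝ) (β : ∀ x : M, TangentSpace 𝓘(ℝ, E) x →L[ℝ] ℝ)
    (L : ∀ x : M, TangentSpace 𝓘(ℝ, E) x → ℝ) : ∀ x : M, TangentSpace 𝓘(ℝ, E) x → ℝ :=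
  fun x y => Real.exp (σ x) * L x y + β x y

variable {E' : Type*} [NormedAddCommGroup E'] [NormedSpace ℝ E']
  {N : Type*} [TopologicalSpace N] [ChartedSpace E' N] [IsManifold 𝓘(ℝ, E') ∞ N]

/-- The metric `L̄(u, v) = L(f(u), df_u(v))` that an immersion `f : N → M` induces on `N`. -/
def induced (f : N → M) (L : ∀ x : M, TangentSpace 𝓘(ℝ, E) x → ℝ) :
    ∀ u : N, TangentSpace 𝓘(ℝ, E') u → ℝ :=
  fun u v => L (f u) (mfderiv 𝓘(ℝ, E') 𝓘(ℝ, E) f u v)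

/-- The immersed submanifold `f : N → M` is totally geodesic for `L`: every geodesic of the
induced metric is, as a curve of `M`, a geodesic of `L`. -/
def IsTotallyGeodesic (f : N → M) (L : ∀ x : M, TangentSpace 𝓘(ℝ, E) x → ℝ) : Prop :=
  ∀ (c : ℝ → N) (J : Set ℝ),
    IsGeodesicOn (E := E') (induced f L) c J → IsGeodesicOn L (fun t => f (c t)) J

end Defs

end Finsler

end

/-!
Let `L'` be a locally Minkowski metric with the same geodesics as `L`, and let `L₁` be any Finsler
metric with the same geodesics as `L`; the metric `L* = e^σ L + β` is one. The metric that makes the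
induced `L₁` projectively flat on the submanifold is the one induced from `L'`.

In a chart `e` of the ambient manifold in which `L'` does not depend on the position, the straight
lines are geodesics of `L'`, hence of `L` and of `L₁` (`IsProjectiveChange.isProjectiveChart`).
For a Finsler function for which straight lines are extremals, the Euler-Lagrange equations of a
regular curve say exactly that its acceleration is a multiple of its velocity, because the kernel of
`∂²F/∂y∂y` at `y` is spanned by `y` (`IsFinslerOn.eulerLagrange_eq_zero_iff`). So two Finsler
metrics for which straight lines are extremals in the same charts are projectively related
(`isProjectiveChange_of_charts`).

It remains to find such charts on the submanifold. Around each of its points the submanifold is a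
graph over its tangent space, in the coordinates of `e` (`exists_graph_chart`). Through every point
and in every direction there is a geodesic of the metric induced from `L`
(`IsFinsler.exists_geodesic`); it is a geodesic of `L` since the submanifold is totally geodesic,
hence straight in `e`. Therefore the second derivative of the coordinate expression `Φ` of the
immersion vanishes (`IsTotallyGeodesic.fderiv_chart_eq`): the submanifold is a piece of a
hyperplane and `Φ` is affine. By naturality of the Euler-Lagrange covector
(`eulerLagrange_induced`), straight lines are then extremals of both induced metrics, and the metric
induced from `L'` does not depend on the position.
-/

noncomputable section

set_option linter.unusedSectionVars false

namespace Finsler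

open Filter Topology Function ContinuousLinearMap

section VectorSpace

variable {E : Type*} [NormedAddCommGroup E] [NormedSpace ℝ E]
  {E' : Type*} [NormedAddCommGroup E'] [NormedSpace ℝ E']

/-! ### The Euler-Lagrange expression in a vector space -/

theorem fderiv_fiber {F : E → E → ℝ} {x y : E} (h : DifferentiableAt ℝ (uncurry F) (x, y))
    (w : E) :
    fderiv ℝ (fun y' => F x y') y w = fderiv ℝ (uncurry F) (x, y) (0, w) := by
  have h1 : HasFDerivAt (fun y' : E => (x, y')) (inr ℝ E E) y := hasFDerivAt_prodMk_right x y
  have h2 : HasFDerivAt (fun y' => F x y') ((fderiv ℝ (uncurry F) (x, y)).comp (inr ℝ E E)) y :=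
    h.hasFDerivAt.comp y h1
  simp [h2.fderiv]

theorem fderiv_base {F : E → E → ℝ} {x y : E} (h : DifferentiableAt ℝ (uncurry F) (x, y))
    (w : E) :
    fderiv ℝ (fun x' => F x' y) x w = fderiv ℝ (uncurry F) (x, y) (w, 0) := by
  have h1 : HasFDerivAt (fun x' : E => (x', y)) (inl ℝ E E) x := hasFDerivAt_prodMk_left x y
  have h2 : HasFDerivAt (fun x' => F x' y) ((fderiv ℝ (uncurry F) (x, y)).comp (inl ℝ E E)) x :=
    h.hasFDerivAt.comp (f := fun x' : E => (x', y)) x h1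
  simp [h2.fderiv]

/-- The Euler-Lagrange covector `d/dt (∂F/∂y) - ∂F/∂x` of `F` along the curve `c` at the time `t`,
applied to the vector `w`. -/
def eulerLagrange (F : E → E → ℝ) (c : ℝ → E) (t : ℝ) (w : E) : ℝ :=
  deriv (fun s => fderiv ℝ (fun y => F (c s) y) (deriv c s) w) t -
    fderiv ℝ (fun x => F x (deriv c t)) (c t) w

theorem _root_.ContDiffAt.hasDerivAt_deriv {c : ℝ → E} {t : ℝ} (hc : ContDiffAt ℝ 2 c t) :
    HasDerivAt (deriv c) (deriv (deriv c) t) t := by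
  have h : ContDiffAt ℝ 1 (deriv c) t := by
    have := hc.fderiv_right (m := 1) (by norm_num [one_add_one_eq_two])
    exact this.clm_apply contDiffAt_const
  exact (h.differentiableAt one_ne_zero).hasDerivAt

theorem _root_.ContDiffAt.eventually_hasDerivAt {c : ℝ → E} {t : ℝ} (hc : ContDiffAt ℝ 2 c t) :
    ∀ᶠ s in 𝓝 t, HasDerivAt c (deriv c s) s := by
  filter_upwards [hc.eventually (by simp)] with s hs
  exact (hs.differentiableAt two_ne_zero).hasDerivAt

theorem _root_.ContDiffAt.hasFDerivAt_fderiv {f : E → E'} {x : E} (hf : ContDiffAt ℝ 2 f x) :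
    HasFDerivAt (fderiv ℝ f) (fderiv ℝ (fderiv ℝ f) x) x := by
  have := hf.fderiv_right (m := 1) (by norm_num [one_add_one_eq_two])
  exact (this.differentiableAt one_ne_zero).hasFDerivAt

/-- The lift of a `C²` curve to the tangent bundle is differentiable. -/
theorem hasDerivAt_lift {c : ℝ → E} {t : ℝ} (hc : ContDiffAt ℝ 2 c t) :
    HasDerivAt (fun s => (c s, deriv c s)) (deriv c t, deriv (deriv c) t) t :=
  hc.eventually_hasDerivAt.self_of_nhds.prodMk hc.hasDerivAt_deriv

/-- The Euler-Lagrange expression as a function of the second order jet of the curve. -/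
theorem eulerLagrange_eq {F : E → E → ℝ} {c : ℝ → E} {t : ℝ}
    (hF : ContDiffAt ℝ 2 (uncurry F) (c t, deriv c t)) (hc : ContDiffAt ℝ 2 c t) (w : E) :
    eulerLagrange F c t w =
      fderiv ℝ (fderiv ℝ (uncurry F)) (c t, deriv c t) (deriv c t, deriv (deriv c) t) (0, w) -
        fderiv ℝ (uncurry F) (c t, deriv c t) (w, 0) := by
  have hz := hasDerivAt_lift hc
  have h1 : HasDerivAt (fun s => fderiv ℝ (uncurry F) (c s, deriv c s) (0, w))
      (fderiv ℝ (fderiv ℝ (uncurry F)) (c t, deriv c t) (deriv c t, deriv (deriv c) t) (0, w)) t := by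
    have := (hF.hasFDerivAt_fderiv.comp_hasDerivAt (f := fun s => (c s, deriv c s)) t hz).clm_apply
      (hasDerivAt_const t ((0, w) : E × E))
    simpa using this
  have h2 : (fun s => fderiv ℝ (fun y => F (c s) y) (deriv c s) w) =ᶠ[𝓝 t]
      fun s => fderiv ℝ (uncurry F) (c s, deriv c s) (0, w) := by
    have := hz.continuousAt.eventually (hF.eventually (by simp))
    filter_upwards [this] with s hs
    exact fderiv_fiber (hs.differentiableAt two_ne_zero) w
  rw [eulerLagrange, h2.deriv_eq, h1.deriv, fderiv_base (hF.differentiableAt two_ne_zero)]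

/-- Naturality of the Euler-Lagrange covector: the covector of the pull-back of `F` by `Φ` along
`c` is the pull-back of the covector of `F` along `Φ ∘ c`. The two terms that contain second
derivatives of `Φ` cancel because these are symmetric. -/
theorem eulerLagrange_comp {F : E → E → ℝ} {G : E' → E' → ℝ} {Φ : E' → E} {c : ℝ → E'} {t : ℝ}
    (hF : ContDiffAt ℝ 2 (uncurry F) (Φ (c t), fderiv ℝ Φ (c t) (deriv c t)))
    (hΦ : ContDiffAt ℝ 2 Φ (c t)) (hc : ContDiffAt ℝ 2 c t)
    (hG : ∀ᶠ x in 𝓝 (c t), ∀ y, G x y = F (Φ x) (fderiv ℝ Φ x y)) (w : E') :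
    eulerLagrange G c t w = eulerLagrange F (fun s => Φ (c s)) t (fderiv ℝ Φ (c t) w) := by
  have hcc : ContinuousAt c t := hc.continuousAt
  have hΦ' : ∀ᶠ s in 𝓝 t, HasFDerivAt Φ (fderiv ℝ Φ (c s)) (c s) := by
    filter_upwards [hcc.eventually (hΦ.eventually (by simp))] with s hs
    exact (hs.differentiableAt two_ne_zero).hasFDerivAt
  have hd : ∀ᶠ s in 𝓝 t, deriv (fun s => Φ (c s)) s = fderiv ℝ Φ (c s) (deriv c s) := by
    filter_upwards [hΦ', hc.eventually_hasDerivAt] with s h1 h2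
    exact (h1.comp_hasDerivAt s h2).deriv
  have hDΦ : HasDerivAt (fun s => fderiv ℝ Φ (c s)) (fderiv ℝ (fderiv ℝ Φ) (c t) (deriv c t)) t :=
    hΦ.hasFDerivAt_fderiv.comp_hasDerivAt t hc.eventually_hasDerivAt.self_of_nhds
  have hz : HasDerivAt (fun s => (Φ (c s), fderiv ℝ Φ (c s) (deriv c s))) _ t :=
    (hΦ'.self_of_nhds.comp_hasDerivAt t hc.eventually_hasDerivAt.self_of_nhds).prodMk
      (hDΦ.clm_apply hc.hasDerivAt_deriv)
  have hFz := hz.continuousAt.eventually (hF.eventually (by simp))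
  have hp := hF.hasFDerivAt_fderiv.comp_hasDerivAt
    (f := fun s => (Φ (c s), fderiv ℝ Φ (c s) (deriv c s))) t hz
  set p := fun s => fderiv ℝ (uncurry F) (Φ (c s), fderiv ℝ Φ (c s) (deriv c s)) with hpdef
  -- the term `d/dt (∂F/∂y)`
  have e1 : deriv (fun s => fderiv ℝ (fun y => F (Φ (c s)) y) (deriv (fun s => Φ (c s)) s)
      (fderiv ℝ Φ (c t) w)) t = deriv (fun s => p s (0, fderiv ℝ Φ (c t) w)) t := by
    refine EventuallyEq.deriv_eq ?_
    filter_upwards [hd, hFz] with s h1 h2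
    rw [h1, fderiv_fiber (h2.differentiableAt two_ne_zero)]
  have e2 : deriv (fun s => fderiv ℝ (fun y => G (c s) y) (deriv c s) w) t =
      deriv (fun s => p s (0, fderiv ℝ Φ (c s) w)) t := by
    refine EventuallyEq.deriv_eq ?_
    filter_upwards [hcc.eventually hG, hFz] with s h1 h2
    have h3 := h2.differentiableAt two_ne_zero
    have h4 : HasFDerivAt (fun y => F (Φ (c s)) y)
        (fderiv ℝ (fun y => F (Φ (c s)) y) (fderiv ℝ Φ (c s) (deriv c s)))
        (fderiv ℝ Φ (c s) (deriv c s)) :=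
      (h3.comp (f := fun y => (Φ (c s), y)) (fderiv ℝ Φ (c s) (deriv c s))
        (hasFDerivAt_prodMk_right _ _).differentiableAt).hasFDerivAt
    have h5 := h4.comp (deriv c s) (fderiv ℝ Φ (c s)).hasFDerivAt
    have h6 : (fun y => G (c s) y) = (fun y => F (Φ (c s)) y) ∘ fderiv ℝ Φ (c s) := by
      ext y; exact h1 y
    rw [h6, h5.fderiv, ContinuousLinearMap.comp_apply, fderiv_fiber h3]
  have d1 := hp.clm_apply (hasDerivAt_const t ((0, fderiv ℝ Φ (c t) w) : E × E))
  have d2 := hp.clm_apply ((hasDerivAt_const t (0 : E)).prodMk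
    (hDΦ.clm_apply (hasDerivAt_const t w)))
  -- the term `∂F/∂x`
  have e3 : fderiv ℝ (fun x => G x (deriv c t)) (c t) w =
      p t (fderiv ℝ Φ (c t) w, fderiv ℝ (fderiv ℝ Φ) (c t) w (deriv c t)) := by
    have h1 : (fun x => G x (deriv c t)) =ᶠ[𝓝 (c t)]
        fun x => uncurry F (Φ x, fderiv ℝ Φ x (deriv c t)) := by
      filter_upwards [hG] with x hx
      exact hx _
    have h2 := (hF.differentiableAt two_ne_zero).hasFDerivAt.comp
      (f := fun x => (Φ x, fderiv ℝ Φ x (deriv c t))) (c t)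
      (hΦ'.self_of_nhds.prodMk (hΦ.hasFDerivAt_fderiv.clm_apply
        (hasFDerivAt_const (deriv c t) (c t))))
    rw [h1.fderiv_eq]
    erw [h2.fderiv]
    simp [hpdef]
  have e4 : fderiv ℝ (fun x => F x (deriv (fun s => Φ (c s)) t)) (Φ (c t)) (fderiv ℝ Φ (c t) w) =
      p t (fderiv ℝ Φ (c t) w, 0) := by
    rw [hd.self_of_nhds, fderiv_base (hF.differentiableAt two_ne_zero)]
  have hsymm : fderiv ℝ (fderiv ℝ Φ) (c t) (deriv c t) w =
      fderiv ℝ (fderiv ℝ Φ) (c t) w (deriv c t) :=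
    (hΦ.isSymmSndFDerivAt (by simp)) _ _
  have hsplit : ∀ a b : E, p t (a, b) = p t (a, 0) + p t (0, b) := fun a b => by
    rw [← map_add]; simp
  rw [eulerLagrange, eulerLagrange, e1, e2, e3, e4]
  erw [d1.deriv, d2.deriv]
  simp only [map_zero, add_zero, hsymm]
  rw [hsplit]
  simp [hpdef]

end VectorSpace

section VectorSpace

variable {E : Type*} [NormedAddCommGroup E] [NormedSpace ℝ E]

/-! ### Finsler functions on an open subset of a vector space -/

/-- `F(x, y)` is a Finsler function on the open subset `U` of a vector space. Positivity of the
fundamental tensor is expressed by `g_y(u, u) = F · ∂²F/∂y∂y (u, u) + (∂F/∂y (u))²`. -/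
structure IsFinslerOn (F : E → E → ℝ) (U : Set E) : Prop where
  isOpen : IsOpen U
  smooth : ∀ x ∈ U, ∀ y : E, y ≠ 0 → ContDiffAt ℝ ∞ (uncurry F) (x, y)
  pos : ∀ x ∈ U, ∀ y : E, y ≠ 0 → 0 < F x y
  homogeneous : ∀ x ∈ U, ∀ (y : E) (t : ℝ), 0 < t → F x (t • y) = t * F x y
  posDef : ∀ x ∈ U, ∀ y u : E, y ≠ 0 → u ≠ 0 →
    0 < F x y * fderiv ℝ (fderiv ℝ (uncurry F)) (x, y) (0, u) (0, u) +
      (fderiv ℝ (uncurry F) (x, y) (0, u)) ^ 2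

/-- The second derivative of `F² / 2` along the fibre. -/
theorem deriv_deriv_sq_half {F : E → E → ℝ} {x y : E} (hF : ContDiffAt ℝ 2 (uncurry F) (x, y))
    (u v : E) :
    deriv (fun s : ℝ => deriv (fun t : ℝ => (F x (y + s • u + t • v)) ^ 2 / 2) 0) 0 =
      F x y * fderiv ℝ (fderiv ℝ (uncurry F)) (x, y) (0, u) (0, v) +
        fderiv ℝ (uncurry F) (x, y) (0, u) * fderiv ℝ (uncurry F) (x, y) (0, v) := by
  have hl : ∀ a b : E, HasDerivAt (fun s : ℝ => (x, a + s • b)) ((0 : E), b) 0 := fun a b => by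
    have : HasDerivAt (fun s : ℝ => a + s • b) b 0 := by
      simpa using ((hasDerivAt_id (0 : ℝ)).smul_const b).const_add a
    exact (hasDerivAt_const (0 : ℝ) x).prodMk this
  have hin : ∀ᶠ s : ℝ in 𝓝 0, ContDiffAt ℝ 2 (uncurry F) (x, y + s • u) :=
    (hl y u).continuousAt.eventually (by simpa using hF.eventually (by simp))
  have h1 : (fun s : ℝ => deriv (fun t : ℝ => (F x (y + s • u + t • v)) ^ 2 / 2) 0) =ᶠ[𝓝 0]
      fun s => uncurry F (x, y + s • u) * fderiv ℝ (uncurry F) (x, y + s • u) (0, v) := by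
    filter_upwards [hin] with s hs
    have h2 : HasFDerivAt (uncurry F) (fderiv ℝ (uncurry F) (x, y + s • u))
        (x, y + s • u + (0 : ℝ) • v) := by
      simpa using (hs.differentiableAt two_ne_zero).hasFDerivAt
    have h3 : HasDerivAt (fun t : ℝ => uncurry F (x, y + s • u + t • v))
        (fderiv ℝ (uncurry F) (x, y + s • u) (0, v)) 0 := by
      have h := h2.comp_hasDerivAt (0 : ℝ) (hl _ v)
      exact h
    have h4 := ((h3.pow 2).div_const 2).deriv
    simp only [zero_smul, add_zero] at h4
    refine h4.trans ?_
    norm_num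
    ring
  have hF' : HasFDerivAt (uncurry F) (fderiv ℝ (uncurry F) (x, y)) (x, y + (0 : ℝ) • u) := by
    simpa using (hF.differentiableAt two_ne_zero).hasFDerivAt
  have hF'' : HasFDerivAt (fderiv ℝ (uncurry F)) (fderiv ℝ (fderiv ℝ (uncurry F)) (x, y))
      (x, y + (0 : ℝ) • u) := by
    simpa using hF.hasFDerivAt_fderiv
  have h4 : HasDerivAt (fun s : ℝ => uncurry F (x, y + s • u))
      (fderiv ℝ (uncurry F) (x, y) (0, u)) 0 := by
    have h := hF'.comp_hasDerivAt (0 : ℝ) (hl y u)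
    exact h
  have h5 : HasDerivAt (fun s : ℝ => fderiv ℝ (uncurry F) (x, y + s • u) (0, v))
      (fderiv ℝ (fderiv ℝ (uncurry F)) (x, y) (0, u) (0, v)) 0 := by
    have h := ((apply ℝ ℝ ((0 : E), v)).hasFDerivAt).comp_hasDerivAt (0 : ℝ)
      (hF''.comp_hasDerivAt (0 : ℝ) (hl y u))
    exact h
  have h6 := (h4.mul h5).deriv
  simp only [zero_smul, add_zero] at h6
  rw [h1.deriv_eq]
  refine h6.trans ?_
  rw [uncurry_apply_pair]
  ring

namespace IsFinslerOn

variable {F : E → E → ℝ} {U : Set E} {x y : E}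

theorem contDiffAt_two (hF : IsFinslerOn F U) (hx : x ∈ U) (hy : y ≠ 0) :
    ContDiffAt ℝ 2 (uncurry F) (x, y) :=
  (hF.smooth x hx y hy).of_le ENat.LEInfty.out

theorem hasFDerivAt (hF : IsFinslerOn F U) (hx : x ∈ U) (hy : y ≠ 0) :
    HasFDerivAt (uncurry F) (fderiv ℝ (uncurry F) (x, y)) (x, y) :=
  ((hF.contDiffAt_two hx hy).differentiableAt two_ne_zero).hasFDerivAt

theorem hasDerivAt_ray (x y : E) (s : ℝ) : HasDerivAt (fun s : ℝ => (x, s • y)) ((0 : E), y) s := by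
  have : HasDerivAt (fun s : ℝ => s • y) y s := by
    simpa using (hasDerivAt_id s).smul_const y
  exact (hasDerivAt_const s x).prodMk this

/-- Euler's identity for `F`, homogeneous of degree one. -/
theorem fderiv_self (hF : IsFinslerOn F U) (hx : x ∈ U) (hy : y ≠ 0) :
    fderiv ℝ (uncurry F) (x, y) (0, y) = F x y := by
  have h0 : HasFDerivAt (uncurry F) (fderiv ℝ (uncurry F) (x, y)) (x, (1 : ℝ) • y) := by
    simpa using hF.hasFDerivAt hx hy
  have h1 := h0.comp_hasDerivAt (1 : ℝ) (hasDerivAt_ray x y 1)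
  have h2 : HasDerivAt (fun s : ℝ => s * F x y) (F x y) 1 := by
    simpa using (hasDerivAt_id (1 : ℝ)).mul_const (F x y)
  have h3 : (uncurry F ∘ fun s : ℝ => (x, s • y)) =ᶠ[𝓝 1] fun s => s * F x y := by
    filter_upwards [lt_mem_nhds (zero_lt_one (α := ℝ))] with s hs
    exact hF.homogeneous x hx y s hs
  exact (h1.congr_of_eventuallyEq h3.symm).unique h2

/-- `∂F/∂y` is homogeneous of degree zero. -/
theorem fderiv_smul (hF : IsFinslerOn F U) (hx : x ∈ U) (hy : y ≠ 0) {s : ℝ} (hs : 0 < s) (w : E) :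
    fderiv ℝ (uncurry F) (x, s • y) (0, w) = fderiv ℝ (uncurry F) (x, y) (0, w) := by
  have hsy : s • y ≠ 0 := smul_ne_zero hs.ne' hy
  have hl : HasDerivAt (fun t : ℝ => (x, s • (y + t • w))) ((0 : E), s • w) 0 := by
    have : HasDerivAt (fun t : ℝ => s • (y + t • w)) (s • w) 0 := by
      have h := ((hasDerivAt_id (0 : ℝ)).smul_const w).const_add y
      rw [one_smul] at h
      exact h.const_smul s
    exact (hasDerivAt_const (0 : ℝ) x).prodMk this
  have hl' : HasDerivAt (fun t : ℝ => (x, y + t • w)) ((0 : E), w) 0 := by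
    have : HasDerivAt (fun t : ℝ => y + t • w) w 0 := by
      simpa using ((hasDerivAt_id (0 : ℝ)).smul_const w).const_add y
    exact (hasDerivAt_const (0 : ℝ) x).prodMk this
  have h0 : HasFDerivAt (uncurry F) (fderiv ℝ (uncurry F) (x, s • y))
      (x, s • (y + (0 : ℝ) • w)) := by simpa using hF.hasFDerivAt hx hsy
  have h0' : HasFDerivAt (uncurry F) (fderiv ℝ (uncurry F) (x, y))
      (x, y + (0 : ℝ) • w) := by simpa using hF.hasFDerivAt hx hy
  have h1 := h0.comp_hasDerivAt (0 : ℝ) hl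
  have h2 := (h0'.comp_hasDerivAt (0 : ℝ) hl').const_mul s
  have h3 : (uncurry F ∘ fun t : ℝ => (x, s • (y + t • w))) =
      fun t => s * (uncurry F ∘ fun t : ℝ => (x, y + t • w)) t := by
    ext t
    exact hF.homogeneous x hx _ s hs
  rw [h3] at h1
  have h4 := h1.unique h2
  have h5 : ((0 : E), s • w) = s • ((0 : E), w) := by simp
  rw [h5, map_smul, smul_eq_mul] at h4
  exact mul_left_cancel₀ hs.ne' h4

/-- `y` is in the kernel of the angular metric `∂²F/∂y∂y`. -/
theorem fderiv_fderiv_self (hF : IsFinslerOn F U) (hx : x ∈ U) (hy : y ≠ 0) (w : E) :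
    fderiv ℝ (fderiv ℝ (uncurry F)) (x, y) (0, y) (0, w) = 0 := by
  have h0 : HasFDerivAt (fderiv ℝ (uncurry F)) (fderiv ℝ (fderiv ℝ (uncurry F)) (x, y))
      (x, (1 : ℝ) • y) := by
    simpa using (hF.contDiffAt_two hx hy).hasFDerivAt_fderiv
  have h1 : HasDerivAt (fun s : ℝ => fderiv ℝ (uncurry F) (x, s • y) (0, w))
      (fderiv ℝ (fderiv ℝ (uncurry F)) (x, y) (0, y) (0, w)) 1 := by
    have h := ((apply ℝ ℝ ((0 : E), w)).hasFDerivAt).comp_hasDerivAt (1 : ℝ)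
      (h0.comp_hasDerivAt (1 : ℝ) (hasDerivAt_ray x y 1))
    exact h
  have h3 : (fun s : ℝ => fderiv ℝ (uncurry F) (x, s • y) (0, w)) =ᶠ[𝓝 1]
      fun _ => fderiv ℝ (uncurry F) (x, y) (0, w) := by
    filter_upwards [lt_mem_nhds (zero_lt_one (α := ℝ))] with s hs
    exact hF.fderiv_smul hx hy hs w
  exact (h1.congr_of_eventuallyEq h3.symm).unique (hasDerivAt_const _ _)

/-- The derivative of Euler's identity with respect to the position. -/
theorem fderiv_fderiv_base_self (hF : IsFinslerOn F U) (hx : x ∈ U) (hy : y ≠ 0) (w : E) :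
    fderiv ℝ (fderiv ℝ (uncurry F)) (x, y) (w, 0) (0, y) =
      fderiv ℝ (uncurry F) (x, y) (w, 0) := by
  have h1 : HasFDerivAt (fun x' : E => (x', y)) (inl ℝ E E) x := hasFDerivAt_prodMk_left x y
  have h2 := ((hF.contDiffAt_two hx hy).hasFDerivAt_fderiv.comp
    (f := fun x' : E => (x', y)) x h1).clm_apply (hasFDerivAt_const (((0 : E), y) : E × E) x)
  have h3 := (hF.hasFDerivAt hx hy).comp (f := fun x' : E => (x', y)) x h1
  have h4 : (fun x' => fderiv ℝ (uncurry F) (x', y) (0, y)) =ᶠ[𝓝 x]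
      uncurry F ∘ fun x' : E => (x', y) := by
    filter_upwards [hF.isOpen.mem_nhds hx] with x' hx'
    exact hF.fderiv_self hx' hy
  have h5 := (h2.congr_of_eventuallyEq h4.symm).unique h3
  simpa using congrArg (fun T => T w) h5

theorem fderiv_fderiv_symm (hF : IsFinslerOn F U) (hx : x ∈ U) (hy : y ≠ 0) (p q : E × E) :
    fderiv ℝ (fderiv ℝ (uncurry F)) (x, y) p q = fderiv ℝ (fderiv ℝ (uncurry F)) (x, y) q p :=
  ((hF.contDiffAt_two hx hy).isSymmSndFDerivAt (by simp)) p q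

/-- The kernel of the angular metric `∂²F/∂y∂y` is spanned by `y`. -/
theorem fderiv_fderiv_eq_zero_iff (hF : IsFinslerOn F U) (hx : x ∈ U) (hy : y ≠ 0) (a : E) :
    (∀ w, fderiv ℝ (fderiv ℝ (uncurry F)) (x, y) (0, a) (0, w) = 0) ↔ ∃ r : ℝ, a = r • y := by
  constructor
  · intro h
    -- subtract from `a` the multiple of `y` on which `∂F/∂y` takes the same value
    set r := fderiv ℝ (uncurry F) (x, y) (0, a) / F x y with hr
    refine ⟨r, ?_⟩
    by_contra hne
    have hu : a - r • y ≠ 0 := sub_ne_zero.mpr hne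
    have hsplit : ((0 : E), a - r • y) = (0, a) - r • (0, y) := by simp
    have hpos := hF.posDef x hx y _ hy hu
    have h1 : fderiv ℝ (uncurry F) (x, y) (0, a - r • y) = 0 := by
      rw [hsplit, map_sub, map_smul, hF.fderiv_self hx hy, hr, smul_eq_mul,
        div_mul_cancel₀ _ (hF.pos x hx y hy).ne', sub_self]
    have h2 : ∀ w, fderiv ℝ (fderiv ℝ (uncurry F)) (x, y) (0, a - r • y) (0, w) = 0 := fun w => by
      rw [hsplit, map_sub, map_smul, sub_apply, smul_apply, h w, hF.fderiv_fderiv_self hx hy]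
      simp
    rw [h1, h2] at hpos
    simp at hpos
  · rintro ⟨r, rfl⟩ w
    have : ((0 : E), r • y) = r • (0, y) := by simp
    rw [this, map_smul, smul_apply, hF.fderiv_fderiv_self hx hy, smul_zero]

/-- If the straight line through `c t` with velocity `c' t`
satisfies the Euler-Lagrange equations, then `c` satisfies them at `t` if and only if its
acceleration is a multiple of its velocity. -/
theorem eulerLagrange_eq_zero_iff (hF : IsFinslerOn F U) {c : ℝ → E} {t : ℝ}
    (hc : ContDiffAt ℝ 2 c t) (hx : c t ∈ U) (hy : deriv c t ≠ 0)
    (hline : ∀ w, eulerLagrange F (fun s => c t + s • deriv c t) 0 w = 0) :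
    (∀ w, eulerLagrange F c t w = 0) ↔ ∃ r : ℝ, deriv (deriv c) t = r • deriv c t := by
  have hl : ∀ s : ℝ, HasDerivAt (fun s : ℝ => c t + s • deriv c t) (deriv c t) s := fun s => by
    simpa using ((hasDerivAt_id s).smul_const (deriv c t)).const_add (c t)
  have hl' : deriv (fun s : ℝ => c t + s • deriv c t) = fun _ => deriv c t :=
    funext fun s => (hl s).deriv
  have hF2 := hF.contDiffAt_two hx hy
  have h0 : ∀ w, fderiv ℝ (fderiv ℝ (uncurry F)) (c t, deriv c t) (deriv c t, 0) (0, w) -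
      fderiv ℝ (uncurry F) (c t, deriv c t) (w, 0) = 0 := fun w => by
    have := hline w
    rw [eulerLagrange_eq (by simpa only [hl', zero_smul, add_zero] using hF2) (by fun_prop)] at this
    simpa only [hl', zero_smul, add_zero, deriv_const] using this
  rw [← hF.fderiv_fderiv_eq_zero_iff hx hy]
  refine forall_congr' fun w => ?_
  have hsplit : (deriv c t, deriv (deriv c) t) = (deriv c t, 0) + (0, deriv (deriv c) t) := by simp
  rw [eulerLagrange_eq hF2 hc, hsplit, map_add, add_apply]
  have := h0 w
  constructor <;> intro h <;> linarith

/-! ### Existence of extremals -/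

section Spray

/-- The fundamental tensor of `F` at the point `p = (x, y)`, as a linear map to the dual space. -/
def metricMap (F : E → E → ℝ) (p : E × E) : E →L[ℝ] (E →L[ℝ] ℝ) :=
  uncurry F p • (precomp ℝ (inr ℝ E E)).comp
      ((fderiv ℝ (fderiv ℝ (uncurry F)) p).comp (inr ℝ E E)) +
    ((fderiv ℝ (uncurry F) p).comp (inr ℝ E E)).smulRight
      ((fderiv ℝ (uncurry F) p).comp (inr ℝ E E))

/-- The covector `F · (∂F/∂x - ∂²F/∂y∂x · y)` at `p = (x, y)`. -/
def forceCovector (F : E → E → ℝ) (p : E × E) : E →L[ℝ] ℝ :=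
  uncurry F p • ((fderiv ℝ (uncurry F) p).comp (inl ℝ E E) -
    (fderiv ℝ (fderiv ℝ (uncurry F)) p (inl ℝ E E p.2)).comp (inr ℝ E E))

/-- The acceleration at `p = (x, y)` of an extremal of `F`. The equations determine it up to a
multiple of `y`; the choice made here is annihilated by `∂F/∂y`. -/
def acceleration (F : E → E → ℝ) (p : E × E) : E :=
  (metricMap F p).inverse (forceCovector F p)

theorem metricMap_apply (p : E × E) (u v : E) :
    metricMap F p u v = uncurry F p * fderiv ℝ (fderiv ℝ (uncurry F)) p (0, u) (0, v) +
      fderiv ℝ (uncurry F) p (0, u) * fderiv ℝ (uncurry F) p (0, v) := by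
  simp [metricMap]

theorem forceCovector_apply (p : E × E) (w : E) :
    forceCovector F p w = uncurry F p * (fderiv ℝ (uncurry F) p (w, 0) -
      fderiv ℝ (fderiv ℝ (uncurry F)) p (p.2, 0) (0, w)) := by
  simp [forceCovector]

theorem metricMap_isInvertible [FiniteDimensional ℝ E] (hF : IsFinslerOn F U) (hx : x ∈ U)
    (hy : y ≠ 0) : ∃ g : E ≃L[ℝ] (E →L[ℝ] ℝ), (g : E →L[ℝ] (E →L[ℝ] ℝ)) = metricMap F (x, y) := by
  have hinj : Injective (metricMap F (x, y) : E →ₗ[ℝ] (E →L[ℝ] ℝ)) := by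
    refine (injective_iff_map_eq_zero _).mpr fun u hu => ?_
    by_contra hne
    have hpos := hF.posDef x hx y u hy hne
    have h0 : metricMap F (x, y) u u = 0 := by
      have : metricMap F (x, y) u = 0 := hu
      rw [this, zero_apply]
    rw [metricMap_apply] at h0
    rw [sq] at hpos
    exact hpos.ne' h0
  have hdim : Module.finrank ℝ E = Module.finrank ℝ (E →L[ℝ] ℝ) := by
    rw [← (LinearMap.toContinuousLinearMap (𝕜 := ℝ) (E := E) (F' := ℝ)).finrank_eq]
    exact (Subspace.dual_finrank_eq (K := ℝ) (V := E)).symm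
  refine ⟨(LinearEquiv.ofInjectiveOfFinrankEq _ hinj hdim).toContinuousLinearEquiv, ?_⟩
  ext u v
  rfl

theorem contDiffAt_acceleration [FiniteDimensional ℝ E] (hF : IsFinslerOn F U) (hx : x ∈ U)
    (hy : y ≠ 0) : ContDiffAt ℝ ∞ (acceleration F) (x, y) := by
  have h0 := hF.smooth x hx y hy
  have h1 : ContDiffAt ℝ ∞ (fderiv ℝ (uncurry F)) (x, y) := h0.fderiv_right (by simp)
  have h2 : ContDiffAt ℝ ∞ (fderiv ℝ (fderiv ℝ (uncurry F))) (x, y) := h1.fderiv_right (by simp)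
  have hl : ContDiffAt ℝ ∞ (fun p => (fderiv ℝ (uncurry F) p).comp (inr ℝ E E)) (x, y) :=
    h1.clm_comp contDiffAt_const
  have hg : ContDiffAt ℝ ∞ (metricMap F) (x, y) := by
    unfold metricMap
    exact (h0.smul (contDiffAt_const.clm_comp (h2.clm_comp contDiffAt_const))).add
      (hl.smulRight hl)
  have hb : ContDiffAt ℝ ∞ (forceCovector F) (x, y) := by
    unfold forceCovector
    refine h0.smul ((h1.clm_comp contDiffAt_const).sub (ContDiffAt.clm_comp ?_ contDiffAt_const))
    exact h2.clm_apply (by fun_prop)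
  obtain ⟨g, hgeq⟩ := hF.metricMap_isInvertible hx hy
  have hinv : ContDiffAt ℝ ∞ (ContinuousLinearMap.inverse : (E →L[ℝ] (E →L[ℝ] ℝ)) → _)
      (metricMap F (x, y)) := hgeq ▸ contDiffAt_map_inverse g
  exact (hinv.comp (x, y) hg).clm_apply hb

/-- The defining equation `g(A, ·) = F · (∂F/∂x - ∂²F/∂y∂x · y)` of the acceleration `A` contains
`∂F/∂y (A) = 0`, its value at `y`, and therefore the Euler-Lagrange equations of `F`. -/
theorem acceleration_spec [FiniteDimensional ℝ E] (hF : IsFinslerOn F U) (hx : x ∈ U)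
    (hy : y ≠ 0) (w : E) :
    fderiv ℝ (fderiv ℝ (uncurry F)) (x, y) (y, acceleration F (x, y)) (0, w) =
      fderiv ℝ (uncurry F) (x, y) (w, 0) := by
  have hpos := hF.pos x hx y hy
  obtain ⟨g, hgeq⟩ := hF.metricMap_isInvertible hx hy
  have hA : metricMap F (x, y) (acceleration F (x, y)) = forceCovector F (x, y) := by
    rw [acceleration, ← hgeq, ContinuousLinearMap.inverse_equiv]
    simp
  set a := acceleration F (x, y)
  have key : ∀ w, metricMap F (x, y) a w = forceCovector F (x, y) w := fun w => by rw [hA]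
  simp only [metricMap_apply, forceCovector_apply, uncurry_apply_pair] at key
  have h1 : fderiv ℝ (uncurry F) (x, y) (0, a) = 0 := by
    have := key y
    rw [hF.fderiv_fderiv_symm hx hy (0, a), hF.fderiv_fderiv_self hx hy, hF.fderiv_self hx hy,
      hF.fderiv_fderiv_base_self hx hy, sub_self, mul_zero, zero_add] at this
    exact (mul_eq_zero.mp this).resolve_right hpos.ne'
  have h2 := key w
  rw [h1, zero_mul, add_zero] at h2
  have h3 := mul_left_cancel₀ hpos.ne' h2
  have hsplit : (y, a) = (y, 0) + (0, a) := by simp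
  rw [hsplit, map_add, add_apply, h3]
  ring

/-- Through every point and in every direction there is a smooth extremal of `F`. -/
theorem exists_extremal [FiniteDimensional ℝ E] (hF : IsFinslerOn F U) (hx : x ∈ U)
    (hy : y ≠ 0) : ∃ (c : ℝ → E) (ε : ℝ), 0 < ε ∧ c 0 = x ∧ deriv c 0 = y ∧
      ∀ t ∈ Ioo (-ε) ε, ContDiffAt ℝ ∞ c t ∧ c t ∈ U ∧ deriv c t ≠ 0 ∧
        ∀ w, eulerLagrange F c t w = 0 := by
  have hX : ∀ p ∈ U ×ˢ ({0}ᶜ : Set E),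
      ContDiffAt ℝ ∞ (fun p : E × E => (p.2, acceleration F p)) p := fun p hp =>
    contDiffAt_snd.prodMk (hF.contDiffAt_acceleration hp.1 hp.2)
  have hopen : IsOpen (U ×ˢ ({0}ᶜ : Set E)) := hF.isOpen.prod isOpen_compl_singleton
  obtain ⟨α, hα0, δ, hδ, hα⟩ :=
    ((hX (x, y) ⟨hx, hy⟩).of_le (m := 1) ENat.LEInfty.out
      ).exists_forall_mem_closedBall_exists_eq_forall_mem_Ioo_hasDerivAt₀ 0
  simp only [zero_sub, zero_add] at hα
  have hcont : ContinuousAt α 0 := (hα 0 (by constructor <;> linarith)).continuousAt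
  have hmem : ∀ᶠ t in 𝓝 (0 : ℝ), α t ∈ U ×ˢ ({0}ᶜ : Set E) :=
    hcont.eventually (hopen.mem_nhds (by rw [hα0]; exact ⟨hx, hy⟩))
  obtain ⟨η, hη, hηm⟩ := Metric.eventually_nhds_iff_ball.mp hmem
  set ε := min δ η / 2 with hε
  have hm : 0 < min δ η := lt_min hδ hη
  have hε0 : 0 < ε := by positivity
  have hεδ : ε < δ := by have := min_le_left δ η; linarith
  have hεη : ε < η := by have := min_le_right δ η; linarith
  have hd : ∀ t ∈ Icc (-ε) ε, HasDerivAt α ((α t).2, acceleration F (α t)) t := fun t ht =>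
    hα t ⟨by linarith [ht.1], by linarith [ht.2]⟩
  have hU : ∀ t ∈ Icc (-ε) ε, α t ∈ U ×ˢ ({0}ᶜ : Set E) := fun t ht =>
    hηm t (by rw [Real.ball_eq_Ioo]; exact ⟨by linarith [ht.1], by linarith [ht.2]⟩)
  have hsm : ContDiffOn ℝ ∞ α (Icc (-ε) ε) :=
    ODE.contDiffOn_enat_Icc_of_hasDerivWithinAt (n := ⊤)
      (f := fun _ p => (p.2, acceleration F p)) (u := U ×ˢ ({0}ᶜ : Set E))
      (fun q hq => ((hX q.2 hq.2).comp (f := Prod.snd) q contDiffAt_snd).contDiffWithinAt)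
      (fun t ht => (hd t ht).hasDerivWithinAt) hU
  have hc1 : ∀ t ∈ Icc (-ε) ε, deriv (fun s => (α s).1) t = (α t).2 := fun t ht =>
    (HasFDerivAt.comp_hasDerivAt t (hasFDerivAt_fst (𝕜 := ℝ) (p := α t)) (hd t ht)).deriv
  have hzero : (0 : ℝ) ∈ Icc (-ε) ε := ⟨by linarith, hε0.le⟩
  refine ⟨fun s => (α s).1, ε, hε0, by simp [hα0], by rw [hc1 0 hzero, hα0], fun t ht => ?_⟩
  have ht' := Ioo_subset_Icc_self ht
  have hsmt : ContDiffAt ℝ ∞ α t := hsm.contDiffAt (Icc_mem_nhds ht.1 ht.2)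
  have hct : ContDiffAt ℝ ∞ (fun s => (α s).1) t := hsmt.fst
  have hxt := (hU t ht').1
  have hyt : (α t).2 ≠ 0 := (hU t ht').2
  refine ⟨hct, hxt, by rwa [hc1 t ht'], fun w => ?_⟩
  have hc2 : deriv (deriv fun s => (α s).1) t = acceleration F (α t) := by
    have h1 : deriv (fun s => (α s).1) =ᶠ[𝓝 t] fun s => (α s).2 := by
      filter_upwards [Icc_mem_nhds ht.1 ht.2] with s hs
      exact hc1 s hs
    rw [h1.deriv_eq]
    exact (HasFDerivAt.comp_hasDerivAt t (hasFDerivAt_snd (𝕜 := ℝ) (p := α t)) (hd t ht')).deriv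
  rw [eulerLagrange_eq (by rw [hc1 t ht']; exact hF.contDiffAt_two hxt hyt)
    (hct.of_le ENat.LEInfty.out), hc2, hc1 t ht']
  have := hF.acceleration_spec hxt hyt w
  rw [← sub_eq_zero] at this
  exact this

end Spray

end IsFinslerOn

end VectorSpace

section Manifolds

variable {E : Type*} [NormedAddCommGroup E] [NormedSpace ℝ E]
  {M : Type*} [TopologicalSpace M] [ChartedSpace E M] [IsManifold 𝓘(ℝ, E) ∞ M]
  {E' : Type*} [NormedAddCommGroup E'] [NormedSpace ℝ E']
  {N : Type*} [TopologicalSpace N] [ChartedSpace E' N] [IsManifold 𝓘(ℝ, E') ∞ N]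

/-! ### Charts, curves and metrics -/

theorem mdifferentiable_of_mem_maximalAtlas {e : OpenPartialHomeomorph M E}
    (he : e ∈ IsManifold.maximalAtlas 𝓘(ℝ, E) ∞ M) : e.MDifferentiable 𝓘(ℝ, E) 𝓘(ℝ, E) :=
  ⟨(contMDiffOn_of_mem_maximalAtlas he).mdifferentiableOn (by simp),
    (contMDiffOn_symm_of_mem_maximalAtlas he).mdifferentiableOn (by simp)⟩

theorem apply_congr (L : ∀ x : M, TangentSpace 𝓘(ℝ, E) x → ℝ) {p q : M} (h : p = q) (v : E) :
    L p v = L q v := by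
  subst h
  rfl

section Chart

variable {f : N → M} {ψ : OpenPartialHomeomorph N E'} {e : OpenPartialHomeomorph M E}

theorem contDiffAt_chart (hf : ContMDiff 𝓘(ℝ, E') 𝓘(ℝ, E) ∞ f)
    (hψ : ψ ∈ IsManifold.maximalAtlas 𝓘(ℝ, E') ∞ N) (he : e ∈ IsManifold.maximalAtlas 𝓘(ℝ, E) ∞ M)
    {x : E'} (hx : x ∈ ψ.target) (hfx : f (ψ.symm x) ∈ e.source) :
    ContDiffAt ℝ ∞ (fun x => e (f (ψ.symm x))) x := by
  have h1 := contMDiffAt_symm_of_mem_maximalAtlas hψ hx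
  have h2 := contMDiffAt_of_mem_maximalAtlas he hfx
  exact (h2.comp x ((hf _).comp x h1)).contDiffAt

theorem fderiv_chart (hf : ContMDiff 𝓘(ℝ, E') 𝓘(ℝ, E) ∞ f)
    (hψ : ψ ∈ IsManifold.maximalAtlas 𝓘(ℝ, E') ∞ N) (he : e ∈ IsManifold.maximalAtlas 𝓘(ℝ, E) ∞ M)
    {x : E'} (hx : x ∈ ψ.target) (hfx : f (ψ.symm x) ∈ e.source) (y : E') :
    fderiv ℝ (fun x => e (f (ψ.symm x))) x y =
      mfderiv 𝓘(ℝ, E) 𝓘(ℝ, E) e (f (ψ.symm x))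
        (mfderiv 𝓘(ℝ, E') 𝓘(ℝ, E) f (ψ.symm x) (mfderiv 𝓘(ℝ, E') 𝓘(ℝ, E') ψ.symm x y)) := by
  have h1 := ((mdifferentiable_of_mem_maximalAtlas hψ).mdifferentiableAt_symm hx).hasMFDerivAt
  have h2 := ((hf (ψ.symm x)).mdifferentiableAt (by simp)).hasMFDerivAt
  have h3 := ((mdifferentiable_of_mem_maximalAtlas he).mdifferentiableAt hfx).hasMFDerivAt
  have h4 := h3.comp x (h2.comp x h1)
  have h5 := h4.mfderiv
  rw [mfderiv_eq_fderiv] at h5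
  exact congrArg (fun T : E' →L[ℝ] E => T y) h5

theorem fderiv_chart_injective (hf : ContMDiff 𝓘(ℝ, E') 𝓘(ℝ, E) ∞ f)
    (hf' : ∀ u, Injective (mfderiv 𝓘(ℝ, E') 𝓘(ℝ, E) f u))
    (hψ : ψ ∈ IsManifold.maximalAtlas 𝓘(ℝ, E') ∞ N) (he : e ∈ IsManifold.maximalAtlas 𝓘(ℝ, E) ∞ M)
    {x : E'} (hx : x ∈ ψ.target) (hfx : f (ψ.symm x) ∈ e.source) :
    Injective (fderiv ℝ (fun x => e (f (ψ.symm x))) x) := by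
  intro y y' h
  rw [fderiv_chart hf hψ he hx hfx, fderiv_chart hf hψ he hx hfx] at h
  exact (mdifferentiable_of_mem_maximalAtlas hψ).symm.mfderiv_injective hx
    (hf' _ ((mdifferentiable_of_mem_maximalAtlas he).mfderiv_injective hfx h))

/-- The induced metric in coordinates is the pull-back, by the coordinate expression of `f`, of the
coordinate expression of the metric. -/
theorem coordExpr_induced (L : ∀ x : M, TangentSpace 𝓘(ℝ, E) x → ℝ)
    (hf : ContMDiff 𝓘(ℝ, E') 𝓘(ℝ, E) ∞ f)
    (hψ : ψ ∈ IsManifold.maximalAtlas 𝓘(ℝ, E') ∞ N) (he : e ∈ IsManifold.maximalAtlas 𝓘(ℝ, E) ∞ M)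
    {x : E'} (hx : x ∈ ψ.target) (hfx : f (ψ.symm x) ∈ e.source) (y : E') :
    coordExpr (induced (E' := E') f L) ψ x y =
      coordExpr L e (e (f (ψ.symm x))) (fderiv ℝ (fun x => e (f (ψ.symm x))) x y) := by
  have h := (mdifferentiable_of_mem_maximalAtlas he).symm_comp_deriv hfx
  have h1 : mfderiv 𝓘(ℝ, E) 𝓘(ℝ, E) e.symm (e (f (ψ.symm x)))
      (fderiv ℝ (fun x => e (f (ψ.symm x))) x y) =
      mfderiv 𝓘(ℝ, E') 𝓘(ℝ, E) f (ψ.symm x) (mfderiv 𝓘(ℝ, E') 𝓘(ℝ, E') ψ.symm x y) := by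
    rw [fderiv_chart hf hψ he hx hfx]
    exact congrArg (fun T : E →L[ℝ] E => T (mfderiv 𝓘(ℝ, E') 𝓘(ℝ, E) f (ψ.symm x)
      (mfderiv 𝓘(ℝ, E') 𝓘(ℝ, E') ψ.symm x y))) h
  refine Eq.trans ?_ (apply_congr L (e.left_inv hfx) _).symm
  exact congrArg (L _) h1.symm

theorem induced_id (L : ∀ x : M, TangentSpace 𝓘(ℝ, E) x → ℝ) :
    induced (E' := E) (fun x : M => x) L = L := by
  funext u v
  have : mfderiv 𝓘(ℝ, E) 𝓘(ℝ, E) (fun x : M => x) u = ContinuousLinearMap.id ℝ _ := mfderiv_id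
  rw [induced, this]
  rfl

theorem IsFinsler.induced {L : ∀ x : M, TangentSpace 𝓘(ℝ, E) x → ℝ} (hL : IsFinsler L)
    (hf : ContMDiff 𝓘(ℝ, E') 𝓘(ℝ, E) ∞ f)
    (hf' : ∀ u, Injective (mfderiv 𝓘(ℝ, E') 𝓘(ℝ, E) f u)) :
    IsFinsler (E := E') (induced (E' := E') f L) := by
  have hne : ∀ (u : N) (v : TangentSpace 𝓘(ℝ, E') u), v ≠ 0 →
      mfderiv 𝓘(ℝ, E') 𝓘(ℝ, E) f u v ≠ 0 := fun u v hv h0 =>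
    hv (hf' u (h0.trans (map_zero _).symm))
  refine ⟨?_, fun u v hv => hL.pos _ _ (hne u v hv), fun u v t ht => ?_, fun u v w hv hw => ?_⟩
  · have h1 : ContMDiff 𝓘(ℝ, E').tangent 𝓘(ℝ, E).tangent ∞
        (tangentMap 𝓘(ℝ, E') 𝓘(ℝ, E) f) := hf.contMDiff_tangentMap (by simp)
    exact hL.smooth.comp (g := fun v : TangentBundle 𝓘(ℝ, E) M => L v.proj v.snd)
      h1.contMDiffOn (fun v hv => hne v.proj v.snd hv)
  · simp only [Finsler.induced, map_smul]
    exact hL.homogeneous _ _ t ht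
  · have := hL.posDef (f u) _ _ (hne u v hv) (hne u w hw)
    simpa only [fundamentalTensor, Finsler.induced, map_add, map_smul] using this

theorem IsFinsler.isFinslerOn_coordExpr {L : ∀ x : M, TangentSpace 𝓘(ℝ, E) x → ℝ}
    (hL : IsFinsler L) (he : e ∈ IsManifold.maximalAtlas 𝓘(ℝ, E) ∞ M) :
    IsFinslerOn (coordExpr L e) e.target := by
  have hne : ∀ x ∈ e.target, ∀ y : E, y ≠ 0 → mfderiv 𝓘(ℝ, E) 𝓘(ℝ, E) e.symm x y ≠ 0 :=
    fun x hx y hy h0 => hy ((mdifferentiable_of_mem_maximalAtlas he).symm.mfderiv_injective hx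
      (h0.trans (map_zero _).symm))
  have hsmooth : ∀ x ∈ e.target, ∀ y : E, y ≠ 0 →
      ContDiffAt ℝ ∞ (uncurry (coordExpr L e)) (x, y) := by
    intro x hx y hy
    have h1 : ContMDiffOn 𝓘(ℝ, E).tangent 𝓘(ℝ, E).tangent ∞
        (tangentMapWithin 𝓘(ℝ, E) 𝓘(ℝ, E) e.symm e.target)
        (Bundle.TotalSpace.proj ⁻¹' e.target) :=
      (contMDiffOn_symm_of_mem_maximalAtlas he).contMDiffOn_tangentMapWithin (by simp)
        e.open_target.uniqueMDiffOn
    have h2 : ContMDiff 𝓘(ℝ, E × E) 𝓘(ℝ, E).tangent ∞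
        (fun p : E × E => (⟨p.1, p.2⟩ : TangentBundle 𝓘(ℝ, E) E)) := by
      have := contMDiff_tangentBundleModelSpaceHomeomorph_symm (I := 𝓘(ℝ, E)) (n := ∞)
      rw [modelWithCornersSelf_prod]
      exact this
    have h3 : ContMDiffOn 𝓘(ℝ, E × E) 𝓘(ℝ, ℝ) ∞ (uncurry (coordExpr L e))
        (e.target ×ˢ ({0}ᶜ : Set E)) := by
      refine ((hL.smooth.comp (t := {v | v.snd ≠ 0})
        ((h1.comp h2.contMDiffOn (s := e.target ×ˢ ({0}ᶜ : Set E))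
          (fun p hp => hp.1))) ?_)).congr ?_
      · rintro ⟨x, y⟩ ⟨hx, hy⟩
        change mfderivWithin 𝓘(ℝ, E) 𝓘(ℝ, E) e.symm e.target x y ≠ 0
        rw [mfderivWithin_of_isOpen e.open_target hx]
        exact hne x hx y hy
      · rintro ⟨x, y⟩ ⟨hx, hy⟩
        change _ = L (e.symm x) (mfderivWithin 𝓘(ℝ, E) 𝓘(ℝ, E) e.symm e.target x y)
        rw [mfderivWithin_of_isOpen e.open_target hx]
        rfl
    exact h3.contDiffOn.contDiffAt
      ((e.open_target.prod isOpen_compl_singleton).mem_nhds ⟨hx, hy⟩)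
  refine ⟨e.open_target, hsmooth, fun x hx y hy => hL.pos _ _ (hne x hx y hy),
    fun x hx y t ht => ?_, fun x hx y u hy hu => ?_⟩
  · let T : E →L[ℝ] E := mfderiv 𝓘(ℝ, E) 𝓘(ℝ, E) e.symm x
    change L (e.symm x) (T (t • y)) = _
    rw [map_smul]
    exact hL.homogeneous _ _ t ht
  · let T : E →L[ℝ] E := mfderiv 𝓘(ℝ, E) 𝓘(ℝ, E) e.symm x
    have h1 := hL.posDef (e.symm x) _ _ (hne x hx y hy) (hne x hx u hu)
    have h2 := deriv_deriv_sq_half ((hsmooth x hx y hy).of_le ENat.LEInfty.out) u u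
    rw [sq, ← h2]
    change 0 < deriv (fun s : ℝ => deriv (fun t : ℝ =>
      (L (e.symm x) (T (y + s • u + t • u))) ^ 2 / 2) 0) 0
    simp only [map_add, map_smul]
    exact h1

end Chart

section Curve

variable {c : ℝ → M} {t : ℝ} {e : OpenPartialHomeomorph M E}

theorem contDiffAt_chart_curve (he : e ∈ IsManifold.maximalAtlas 𝓘(ℝ, E) ∞ M)
    (hc : ContMDiffAt 𝓘(ℝ, ℝ) 𝓘(ℝ, E) ∞ c t) (ht : c t ∈ e.source) :
    ContDiffAt ℝ ∞ (fun s => e (c s)) t :=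
  ((contMDiffAt_of_mem_maximalAtlas he ht).comp t hc).contDiffAt

theorem deriv_chart_curve (he : e ∈ IsManifold.maximalAtlas 𝓘(ℝ, E) ∞ M)
    (hc : ContMDiffAt 𝓘(ℝ, ℝ) 𝓘(ℝ, E) ∞ c t) (ht : c t ∈ e.source) :
    deriv (fun s => e (c s)) t =
      mfderiv 𝓘(ℝ, E) 𝓘(ℝ, E) e (c t) (mfderiv 𝓘(ℝ, ℝ) 𝓘(ℝ, E) c t (1 : ℝ)) := by
  have h1 := ((mdifferentiable_of_mem_maximalAtlas he).mdifferentiableAt ht).hasMFDerivAt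
  have h2 := (hc.mdifferentiableAt (by simp)).hasMFDerivAt
  have h3 := (h1.comp t h2).mfderiv
  rw [mfderiv_eq_fderiv] at h3
  rw [← fderiv_apply_one_eq_deriv]
  exact congrArg (fun T : ℝ →L[ℝ] E => T 1) h3

theorem deriv_chart_curve_ne_zero_iff (he : e ∈ IsManifold.maximalAtlas 𝓘(ℝ, E) ∞ M)
    (hc : ContMDiffAt 𝓘(ℝ, ℝ) 𝓘(ℝ, E) ∞ c t) (ht : c t ∈ e.source) :
    deriv (fun s => e (c s)) t ≠ 0 ↔ mfderiv 𝓘(ℝ, ℝ) 𝓘(ℝ, E) c t (1 : ℝ) ≠ 0 := by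
  rw [deriv_chart_curve he hc ht, not_iff_not]
  exact map_eq_zero_iff _ ((mdifferentiable_of_mem_maximalAtlas he).mfderiv_injective ht)

end Curve

theorem eulerLagrangeAt_iff (L : ∀ x : M, TangentSpace 𝓘(ℝ, E) x → ℝ)
    (e : OpenPartialHomeomorph M E) (c : ℝ → M) (t : ℝ) :
    EulerLagrangeAt L e c t ↔ ∀ w, eulerLagrange (coordExpr L e) (fun s => e (c s)) t w = 0 :=
  forall_congr' fun _ => sub_eq_zero.symm

theorem eulerLagrange_congr {F : E → E → ℝ} {c c' : ℝ → E} {t : ℝ} (h : c =ᶠ[𝓝 t] c') (w : E) :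
    eulerLagrange F c t w = eulerLagrange F c' t w := by
  have h1 : (fun s => fderiv ℝ (fun y => F (c s) y) (deriv c s) w) =ᶠ[𝓝 t]
      fun s => fderiv ℝ (fun y => F (c' s) y) (deriv c' s) w := by
    filter_upwards [h, h.deriv] with s h1 h2
    rw [h1, h2]
  rw [eulerLagrange, eulerLagrange, h1.deriv_eq, h.deriv_eq, h.eq_of_nhds]

/-- The Euler-Lagrange covector of the induced metric is the pull-back of the Euler-Lagrange
covector of the metric. -/
theorem eulerLagrange_induced {f : N → M} {ψ : OpenPartialHomeomorph N E'}
    {e : OpenPartialHomeomorph M E} {L : ∀ x : M, TangentSpace 𝓘(ℝ, E) x → ℝ} (hL : IsFinsler L)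
    (hf : ContMDiff 𝓘(ℝ, E') 𝓘(ℝ, E) ∞ f)
    (hf' : ∀ u, Injective (mfderiv 𝓘(ℝ, E') 𝓘(ℝ, E) f u))
    (hψ : ψ ∈ IsManifold.maximalAtlas 𝓘(ℝ, E') ∞ N) (he : e ∈ IsManifold.maximalAtlas 𝓘(ℝ, E) ∞ M)
    {γ : ℝ → E'} {t : ℝ} (hγ : ContDiffAt ℝ ∞ γ t) (hγ' : deriv γ t ≠ 0)
    (hx : γ t ∈ ψ.target) (hfx : f (ψ.symm (γ t)) ∈ e.source) (w : E') :
    eulerLagrange (coordExpr (induced (E' := E') f L) ψ) γ t w =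
      eulerLagrange (coordExpr L e) (fun s => e (f (ψ.symm (γ s)))) t
        (fderiv ℝ (fun x => e (f (ψ.symm x))) (γ t) w) := by
  have hΦ := contDiffAt_chart hf hψ he hx hfx
  have hinj := fderiv_chart_injective hf hf' hψ he hx hfx
  refine eulerLagrange_comp (Φ := fun x => e (f (ψ.symm x)))
    ((hL.isFinslerOn_coordExpr he).contDiffAt_two (e.map_source hfx) fun h0 =>
      hγ' (hinj (h0.trans (map_zero _).symm)))
    (hΦ.of_le ENat.LEInfty.out) (hγ.of_le ENat.LEInfty.out) ?_ w
  have hc : ContinuousAt (fun x => f (ψ.symm x)) (γ t) :=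
    hf.continuous.continuousAt.comp (ψ.continuousAt_symm hx)
  filter_upwards [ψ.open_target.mem_nhds hx, hc.eventually (e.open_source.mem_nhds hfx)]
    with x h1 h2 y
  exact coordExpr_induced L hf hψ he h1 h2 y

/-- The Euler-Lagrange equations are independent of the chart. -/
theorem eulerLagrangeAt_of_chart {L : ∀ x : M, TangentSpace 𝓘(ℝ, E) x → ℝ} (hL : IsFinsler L)
    {c : ℝ → M} {t : ℝ} (hc : ContMDiffAt 𝓘(ℝ, ℝ) 𝓘(ℝ, E) ∞ c t)
    (hc' : mfderiv 𝓘(ℝ, ℝ) 𝓘(ℝ, E) c t (1 : ℝ) ≠ 0) {e e' : OpenPartialHomeomorph M E}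
    (he : e ∈ IsManifold.maximalAtlas 𝓘(ℝ, E) ∞ M) (he' : e' ∈ IsManifold.maximalAtlas 𝓘(ℝ, E) ∞ M)
    (ht : c t ∈ e.source) (ht' : c t ∈ e'.source) (h : EulerLagrangeAt L e c t) :
    EulerLagrangeAt L e' c t := by
  rw [eulerLagrangeAt_iff] at h ⊢
  intro w
  have hid : ContMDiff 𝓘(ℝ, E) 𝓘(ℝ, E) ∞ (fun x : M => x) := contMDiff_id
  have hid' : ∀ u : M, Injective (mfderiv 𝓘(ℝ, E) 𝓘(ℝ, E) (fun x : M => x) u) := fun u => by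
    have : mfderiv 𝓘(ℝ, E) 𝓘(ℝ, E) (fun x : M => x) u = ContinuousLinearMap.id ℝ _ := mfderiv_id
    rw [this]
    exact injective_id
  have h1 := eulerLagrange_induced hL hid hid' he' he (contDiffAt_chart_curve he' hc ht')
    ((deriv_chart_curve_ne_zero_iff he' hc ht').mpr hc') (e'.map_source ht')
    (by rwa [e'.left_inv ht']) w
  rw [induced_id] at h1
  have h2 : (fun s => e (e'.symm (e' (c s)))) =ᶠ[𝓝 t] fun s => e (c s) := by
    filter_upwards [hc.continuousAt.eventually (e'.open_source.mem_nhds ht')] with s hs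
    rw [e'.left_inv hs]
  rw [h1, eulerLagrange_congr h2, h]

theorem isGeodesicOn_of_charts {L : ∀ x : M, TangentSpace 𝓘(ℝ, E) x → ℝ} (hL : IsFinsler L)
    {c : ℝ → M} {J : Set ℝ} (hJ : IsOpen J) (hJ' : J.OrdConnected)
    (hc : ContMDiffOn 𝓘(ℝ, ℝ) 𝓘(ℝ, E) ∞ c J)
    (hc' : ∀ t ∈ J, mfderiv 𝓘(ℝ, ℝ) 𝓘(ℝ, E) c t (1 : ℝ) ≠ 0)
    (h : ∀ t ∈ J, ∃ e ∈ IsManifold.maximalAtlas 𝓘(ℝ, E) ∞ M, c t ∈ e.source ∧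
      EulerLagrangeAt L e c t) : IsGeodesicOn L c J where
  isOpen := hJ
  ordConnected := hJ'
  smooth := hc
  regular := hc'
  eulerLagrange t ht e' he' hte' := by
    obtain ⟨e, he, hte, hE⟩ := h t ht
    exact eulerLagrangeAt_of_chart hL (hc.contMDiffAt (hJ.mem_nhds ht)) (hc' t ht) he he' hte hte' hE

/-- A curve in a chart that satisfies the Euler-Lagrange equations there is a geodesic. -/
theorem isGeodesicOn_symm_comp {L : ∀ x : M, TangentSpace 𝓘(ℝ, E) x → ℝ} (hL : IsFinsler L)
    {e : OpenPartialHomeomorph M E} (he : e ∈ IsManifold.maximalAtlas 𝓘(ℝ, E) ∞ M)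
    {γ : ℝ → E} {J : Set ℝ} (hJ : IsOpen J) (hJ' : J.OrdConnected)
    (hγ : ∀ t ∈ J, ContDiffAt ℝ ∞ γ t ∧ γ t ∈ e.target ∧ deriv γ t ≠ 0 ∧
      ∀ w, eulerLagrange (coordExpr L e) γ t w = 0) :
    IsGeodesicOn L (fun t => e.symm (γ t)) J := by
  have hsm : ∀ t ∈ J, ContMDiffAt 𝓘(ℝ, ℝ) 𝓘(ℝ, E) ∞ (fun t => e.symm (γ t)) t := fun t ht =>
    (contMDiffAt_symm_of_mem_maximalAtlas he (hγ t ht).2.1).comp t (hγ t ht).1.contMDiffAt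
  have heq : ∀ t ∈ J, (fun s => e (e.symm (γ s))) =ᶠ[𝓝 t] γ := fun t ht => by
    filter_upwards [(hγ t ht).1.continuousAt.eventually (e.open_target.mem_nhds (hγ t ht).2.1)]
      with s hs
    exact e.right_inv hs
  have hmem : ∀ t ∈ J, e.symm (γ t) ∈ e.source := fun t ht => e.map_target (hγ t ht).2.1
  refine isGeodesicOn_of_charts hL hJ hJ' (fun t ht => (hsm t ht).contMDiffWithinAt)
    (fun t ht => ?_) fun t ht => ⟨e, he, hmem t ht, ?_⟩
  · rw [← deriv_chart_curve_ne_zero_iff he (hsm t ht) (hmem t ht), (heq t ht).deriv_eq]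
    exact (hγ t ht).2.2.1
  · rw [eulerLagrangeAt_iff]
    intro w
    rw [eulerLagrange_congr (heq t ht)]
    exact (hγ t ht).2.2.2 w

end Manifolds

section Flat

variable {E : Type*} [NormedAddCommGroup E] [NormedSpace ℝ E]
  {M : Type*} [TopologicalSpace M] [ChartedSpace E M] [IsManifold 𝓘(ℝ, E) ∞ M]
  {E' : Type*} [NormedAddCommGroup E'] [NormedSpace ℝ E']
  {N : Type*} [TopologicalSpace N] [ChartedSpace E' N] [IsManifold 𝓘(ℝ, E') ∞ N]

/-! ### Straight lines -/

theorem hasDerivAt_line (x y : E) (s : ℝ) : HasDerivAt (fun s : ℝ => x + s • y) y s := by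
  simpa using ((hasDerivAt_id s).smul_const y).const_add x

theorem deriv_line (x y : E) : deriv (fun s : ℝ => x + s • y) = fun _ => y :=
  funext fun s => (hasDerivAt_line x y s).deriv

/-- Straight lines are extremals of a function that does not depend on the position. -/
theorem eulerLagrange_line_of_const {F : E → E → ℝ} {U : Set E} (hU : IsOpen U)
    (hF : ∀ x ∈ U, ∀ x' ∈ U, ∀ y, F x y = F x' y) {x y : E} {t : ℝ} (hx : x + t • y ∈ U) (w : E) :
    eulerLagrange F (fun s => x + s • y) t w = 0 := by
  have h1 : (fun s : ℝ => fderiv ℝ (fun y' => F (x + s • y) y')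
      (deriv (fun s : ℝ => x + s • y) s) w) =ᶠ[𝓝 t]
      fun _ => fderiv ℝ (fun y' => F (x + t • y) y') y w := by
    filter_upwards [(hasDerivAt_line x y t).continuousAt.eventually (hU.mem_nhds hx)] with s hs
    rw [deriv_line, funext (hF _ hs _ hx)]
  have h2 : (fun x' => F x' (deriv (fun s : ℝ => x + s • y) t)) =ᶠ[𝓝 (x + t • y)]
      fun _ => F (x + t • y) y := by
    filter_upwards [hU.mem_nhds hx] with x' hx'
    rw [deriv_line]
    exact hF _ hx' _ hx _
  rw [eulerLagrange, h1.deriv_eq, h2.fderiv_eq]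
  simp

/-- `e` is a chart in which the straight lines satisfy the Euler-Lagrange equations of `L`. -/
def IsProjectiveChart (L : ∀ x : M, TangentSpace 𝓘(ℝ, E) x → ℝ) (e : OpenPartialHomeomorph M E) :
    Prop :=
  ∀ x ∈ e.target, ∀ y : E, y ≠ 0 → ∀ w : E,
    eulerLagrange (coordExpr L e) (fun s => x + s • y) 0 w = 0

/-- If straight lines are extremals in the chart `e`, the Euler-Lagrange equations in `e` say that
the acceleration is a multiple of the velocity. -/
theorem IsProjectiveChart.eulerLagrangeAt_iff {L : ∀ x : M, TangentSpace 𝓘(ℝ, E) x → ℝ}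
    {e : OpenPartialHomeomorph M E} (h : IsProjectiveChart L e) (hL : IsFinsler L)
    (he : e ∈ IsManifold.maximalAtlas 𝓘(ℝ, E) ∞ M) {c : ℝ → M} {t : ℝ}
    (hc : ContMDiffAt 𝓘(ℝ, ℝ) 𝓘(ℝ, E) ∞ c t)
    (hc' : mfderiv 𝓘(ℝ, ℝ) 𝓘(ℝ, E) c t (1 : ℝ) ≠ 0) (ht : c t ∈ e.source) :
    EulerLagrangeAt L e c t ↔
      ∃ r : ℝ, deriv (deriv fun s => e (c s)) t = r • deriv (fun s => e (c s)) t := by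
  have h0 := (deriv_chart_curve_ne_zero_iff he hc ht).mpr hc'
  rw [Finsler.eulerLagrangeAt_iff]
  exact (hL.isFinslerOn_coordExpr he).eulerLagrange_eq_zero_iff
    ((contDiffAt_chart_curve he hc ht).of_le ENat.LEInfty.out) (e.map_source ht) h0
    (h _ (e.map_source ht) _ h0)

/-- The straight lines in an adapted chart of a locally Minkowski space `L'` are geodesics of `L'`,
and so they are extremals of every projectively related metric. -/
theorem IsProjectiveChange.isProjectiveChart {L L' : ∀ x : M, TangentSpace 𝓘(ℝ, E) x → ℝ}
    (h : IsProjectiveChange L L') (hL' : IsFinsler L')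
    {e : OpenPartialHomeomorph M E} (he : e ∈ IsManifold.maximalAtlas 𝓘(ℝ, E) ∞ M)
    (hconst : ∀ x ∈ e.target, ∀ x' ∈ e.target, ∀ y : E, coordExpr L' e x y = coordExpr L' e x' y) :
    IsProjectiveChart L e := by
  intro x hx y hy w
  have hev : ∀ᶠ s : ℝ in 𝓝 0, x + s • y ∈ e.target :=
    (hasDerivAt_line x y 0).continuousAt.eventually (e.open_target.mem_nhds (by simpa using hx))
  obtain ⟨ε, hε, hball⟩ := Metric.eventually_nhds_iff_ball.mp hev
  rw [Real.ball_eq_Ioo] at hball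
  have h1 : IsGeodesicOn L' (fun s => e.symm (x + s • y)) (Ioo (0 - ε) (0 + ε)) :=
    isGeodesicOn_symm_comp hL' he isOpen_Ioo ordConnected_Ioo fun s hs =>
      ⟨by fun_prop, hball s hs, by rwa [deriv_line],
        eulerLagrange_line_of_const e.open_target hconst (hball s hs)⟩
  have h0 : (0 : ℝ) ∈ Ioo (0 - ε) (0 + ε) := ⟨by linarith, by linarith⟩
  have hmem : e.symm (x + (0 : ℝ) • y) ∈ e.source := e.map_target (hball 0 h0)
  have h2 := (eulerLagrangeAt_iff _ _ _ _).mp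
    (((h _ _).mpr h1).eulerLagrange 0 h0 e he hmem) w
  have h3 : (fun s : ℝ => e (e.symm (x + s • y))) =ᶠ[𝓝 0] fun s => x + s • y := by
    filter_upwards [hev] with s hs
    exact e.right_inv hs
  rwa [eulerLagrange_congr h3] at h2

/-- Two metrics for which the straight lines in the same charts are extremals have the same
geodesics. -/
theorem isProjectiveChange_of_charts {L L' : ∀ x : M, TangentSpace 𝓘(ℝ, E) x → ℝ}
    (hL : IsFinsler L) (hL' : IsFinsler L')
    (h : ∀ p : M, ∃ e ∈ IsManifold.maximalAtlas 𝓘(ℝ, E) ∞ M, p ∈ e.source ∧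
      IsProjectiveChart L e ∧ IsProjectiveChart L' e) : IsProjectiveChange L L' := by
  intro c J
  constructor
  · intro hc
    refine isGeodesicOn_of_charts hL' hc.isOpen hc.ordConnected hc.smooth hc.regular fun t ht => ?_
    obtain ⟨e, he, hte, h1, h2⟩ := h (c t)
    have hct := hc.smooth.contMDiffAt (hc.isOpen.mem_nhds ht)
    refine ⟨e, he, hte, (h2.eulerLagrangeAt_iff hL' he hct (hc.regular t ht) hte).mpr ?_⟩
    exact (h1.eulerLagrangeAt_iff hL he hct (hc.regular t ht) hte).mp
      (hc.eulerLagrange t ht e he hte)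
  · intro hc
    refine isGeodesicOn_of_charts hL hc.isOpen hc.ordConnected hc.smooth hc.regular fun t ht => ?_
    obtain ⟨e, he, hte, h1, h2⟩ := h (c t)
    have hct := hc.smooth.contMDiffAt (hc.isOpen.mem_nhds ht)
    refine ⟨e, he, hte, (h1.eulerLagrangeAt_iff hL he hct (hc.regular t ht) hte).mpr ?_⟩
    exact (h2.eulerLagrangeAt_iff hL' he hct (hc.regular t ht) hte).mp
      (hc.eulerLagrange t ht e he hte)

/-- Through every point and in every direction there is a geodesic. -/
theorem IsFinsler.exists_geodesic [FiniteDimensional ℝ E]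
    {L : ∀ x : M, TangentSpace 𝓘(ℝ, E) x → ℝ} (hL : IsFinsler L)
    {e : OpenPartialHomeomorph M E} (he : e ∈ IsManifold.maximalAtlas 𝓘(ℝ, E) ∞ M)
    {x y : E} (hx : x ∈ e.target) (hy : y ≠ 0) :
    ∃ (γ : ℝ → E) (ε : ℝ), 0 < ε ∧ ContDiffAt ℝ ∞ γ 0 ∧ γ 0 = x ∧ deriv γ 0 = y ∧
      IsGeodesicOn L (fun t => e.symm (γ t)) (Ioo (-ε) ε) := by
  obtain ⟨γ, ε, hε, h0, h1, h2⟩ := (hL.isFinslerOn_coordExpr he).exists_extremal hx hy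
  exact ⟨γ, ε, hε, (h2 0 ⟨by linarith, hε⟩).1, h0, h1,
    isGeodesicOn_symm_comp hL he isOpen_Ioo ordConnected_Ioo h2⟩

/-! ### Adapted charts of a totally geodesic immersion -/

theorem deriv_comp_curve {Φ : E' → E} {γ : ℝ → E'} {t : ℝ} (hΦ : ContDiffAt ℝ 2 Φ (γ t))
    (hγ : ContDiffAt ℝ 2 γ t) :
    (deriv fun s => Φ (γ s)) =ᶠ[𝓝 t] fun s => fderiv ℝ Φ (γ s) (deriv γ s) := by
  filter_upwards [hγ.continuousAt.eventually (hΦ.eventually (by simp)), hγ.eventually_hasDerivAt]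
    with s h1 h2
  exact ((h1.differentiableAt two_ne_zero).hasFDerivAt.comp_hasDerivAt s h2).deriv

theorem deriv_deriv_comp_curve {Φ : E' → E} {γ : ℝ → E'} {t : ℝ} (hΦ : ContDiffAt ℝ 2 Φ (γ t))
    (hγ : ContDiffAt ℝ 2 γ t) :
    deriv (deriv fun s => Φ (γ s)) t =
      fderiv ℝ (fderiv ℝ Φ) (γ t) (deriv γ t) (deriv γ t) +
        fderiv ℝ Φ (γ t) (deriv (deriv γ) t) := by
  have h1 : HasDerivAt (fun s => fderiv ℝ Φ (γ s)) (fderiv ℝ (fderiv ℝ Φ) (γ t) (deriv γ t)) t :=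
    hΦ.hasFDerivAt_fderiv.comp_hasDerivAt t hγ.eventually_hasDerivAt.self_of_nhds
  rw [(deriv_comp_curve hΦ hγ).deriv_eq]
  exact (h1.clm_apply hγ.hasDerivAt_deriv).deriv

/-- Around every point of an immersed submanifold there is a chart `ψ`, onto a ball, in which the
coordinate expression of the immersion has a linear left inverse: the submanifold is a graph over
its tangent space. -/
theorem exists_graph_chart [FiniteDimensional ℝ E] [FiniteDimensional ℝ E'] {f : N → M}
    (hf : ContMDiff 𝓘(ℝ, E') 𝓘(ℝ, E) ∞ f)
    (hf' : ∀ u, Injective (mfderiv 𝓘(ℝ, E') 𝓘(ℝ, E) f u)) (p : N)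
    {e : OpenPartialHomeomorph M E} (he : e ∈ IsManifold.maximalAtlas 𝓘(ℝ, E) ∞ M)
    (hp : f p ∈ e.source) :
    ∃ ψ ∈ IsManifold.maximalAtlas 𝓘(ℝ, E') ∞ N, p ∈ ψ.source ∧ IsPreconnected ψ.target ∧
      (∀ x ∈ ψ.target, f (ψ.symm x) ∈ e.source) ∧
      ∃ P : E →L[ℝ] E', ∀ x ∈ ψ.target, P (e (f (ψ.symm x))) = x := by
  have : CompleteSpace E' := FiniteDimensional.complete ℝ E'
  set φ := chartAt E' p with hφ
  have hφm : φ ∈ IsManifold.maximalAtlas 𝓘(ℝ, E') ∞ N := IsManifold.chart_mem_maximalAtlas p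
  have hpφ : p ∈ φ.source := mem_chart_source E' p
  set x₀ := φ p with hx₀
  have hx₀t : x₀ ∈ φ.target := φ.map_source hpφ
  have hx₀e : f (φ.symm x₀) ∈ e.source := by rwa [hx₀, φ.left_inv hpφ]
  obtain ⟨P₀, hP₀⟩ := LinearMap.exists_leftInverse_of_injective
    (fderiv ℝ (fun x => e (f (φ.symm x))) x₀ : E' →ₗ[ℝ] E)
    (LinearMap.ker_eq_bot.mpr (fderiv_chart_injective hf hf' hφm he hx₀t hx₀e))
  set P : E →L[ℝ] E' := LinearMap.toContinuousLinearMap P₀ with hP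
  set T : E' → E' := fun x => P (e (f (φ.symm x))) with hT
  -- the domain of the coordinate expression of `f`
  set S := φ.target ∩ φ.symm ⁻¹' (f ⁻¹' e.source) with hS
  have hSo : IsOpen S := φ.symm.isOpen_inter_preimage (e.open_source.preimage hf.continuous)
  have hTs : ∀ x ∈ S, ContDiffAt ℝ ∞ T x := fun x hx =>
    P.contDiff.contDiffAt.comp x (contDiffAt_chart hf hφm he hx.1 hx.2)
  have hTd : HasFDerivAt T ((ContinuousLinearEquiv.refl ℝ E' : E' ≃L[ℝ] E') : E' →L[ℝ] E') x₀ := by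
    have h1 := P.hasFDerivAt.comp x₀
      ((contDiffAt_chart hf hφm he hx₀t hx₀e).differentiableAt (by simp)).hasFDerivAt
    refine h1.congr_fderiv ?_
    ext v
    exact congrArg (fun A : E' →ₗ[ℝ] E' => A v) hP₀
  have hx₀S : x₀ ∈ S := ⟨hx₀t, hx₀e⟩
  set τ := (hTs x₀ hx₀S).toOpenPartialHomeomorph T hTd (by simp) with hτ
  have hx₀τ : x₀ ∈ τ.source :=
    (hTs x₀ hx₀S).mem_toOpenPartialHomeomorph_source hTd (by simp)
  -- the points at which the inverse of `T` is smooth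
  set V := S ∩ fderiv ℝ T ⁻¹' (range ((↑) : (E' ≃L[ℝ] E') → (E' →L[ℝ] E'))) with hV
  have hVo : IsOpen V := ContinuousOn.isOpen_inter_preimage
    (fun x hx => ((hTs x hx).fderiv_right (m := 0) (by simp)).continuousAt.continuousWithinAt) hSo
    (ContinuousLinearEquiv.isOpen)
  have hx₀V : x₀ ∈ V := ⟨hx₀S, ContinuousLinearEquiv.refl ℝ E', hTd.fderiv.symm⟩
  set χ := φ.trans (τ.restr V) with hχ
  have hpχ : p ∈ χ.source := by
    simp only [hχ, OpenPartialHomeomorph.trans_source, OpenPartialHomeomorph.restr_source,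
      hVo.interior_eq]
    exact ⟨hpφ, hx₀τ, hx₀V⟩
  obtain ⟨ε, hε, hball⟩ := Metric.isOpen_iff.mp χ.open_target (χ p) (χ.map_source hpχ)
  set ψ := χ.trans (OpenPartialHomeomorph.ofSet (Metric.ball (χ p) ε) Metric.isOpen_ball) with hψ
  have hψt : ψ.target = Metric.ball (χ p) ε := by
    rw [hψ, OpenPartialHomeomorph.trans_target]
    simpa using hball
  have hsymm : ∀ x, ψ.symm x = φ.symm (τ.symm x) := fun x => rfl
  have htarget : ∀ x ∈ ψ.target, x ∈ τ.target ∧ τ.symm x ∈ V := fun x hx => by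
    have h1 : x ∈ χ.target := hball (hψt ▸ hx)
    simp only [hχ, OpenPartialHomeomorph.trans_target, OpenPartialHomeomorph.restr_target,
      hVo.interior_eq] at h1
    exact h1.1
  have hleft : ∀ x ∈ ψ.target, P (e (f (ψ.symm x))) = x := fun x hx =>
    τ.right_inv (htarget x hx).1
  refine ⟨ψ, ?_, ?_, ?_, fun x hx => (htarget x hx).2.1.2, P, hleft⟩
  · refine ψ.mem_maximalAtlas_of_contMDiffOn (fun u hu => ?_) fun x hx => ?_
    · have h1 : ψ u ∈ ψ.target := ψ.map_source hu
      have h2 : f u ∈ e.source := by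
        have := (htarget _ h1).2.1.2
        change f (ψ.symm (ψ u)) ∈ e.source at this
        rwa [ψ.left_inv hu] at this
      have h3 : ContMDiffAt 𝓘(ℝ, E') 𝓘(ℝ, E') ∞ (fun u => P (e (f u))) u :=
        P.contMDiff.contMDiffAt.comp u ((contMDiffAt_of_mem_maximalAtlas he h2).comp u (hf u))
      refine (h3.congr_of_eventuallyEq ?_).contMDiffWithinAt
      filter_upwards [ψ.open_source.mem_nhds hu] with v hv
      have := hleft _ (ψ.map_source hv)
      rw [ψ.left_inv hv] at this
      exact this.symm
    · obtain ⟨h1, h2, A, hA⟩ := htarget x hx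
      have h3 : ContDiffAt ℝ ∞ τ.symm x := τ.contDiffAt_symm h1 (f₀' := A)
        (by rw [hA]; exact ((hTs _ h2).differentiableAt (by simp)).hasFDerivAt) (hTs _ h2)
      exact ((contMDiffAt_symm_of_mem_maximalAtlas hφm h2.1).comp x
        h3.contMDiffAt).contMDiffWithinAt
  · rw [hψ, OpenPartialHomeomorph.trans_source]
    exact ⟨hpχ, by simpa using hε⟩
  · rw [hψt]
    exact (convex_ball _ _).isPreconnected

/-- In a graph chart of a totally geodesic submanifold, over a chart of the ambient manifold in
which straight lines are extremals, the coordinate expression `Φ` of the immersion has constant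
derivative: for a geodesic `γ` of the induced metric, `Φ ∘ γ` and its projection `γ` have
accelerations that are the same multiple of their velocities, so `D²Φ` vanishes on the velocity of
`γ`. -/
theorem IsTotallyGeodesic.fderiv_chart_eq [FiniteDimensional ℝ E']
    {f : N → M} {L : ∀ x : M, TangentSpace 𝓘(ℝ, E) x → ℝ}
    (hgeo : IsTotallyGeodesic (E' := E') f L) (hL : IsFinsler L)
    (hf : ContMDiff 𝓘(ℝ, E') 𝓘(ℝ, E) ∞ f)
    (hf' : ∀ u, Injective (mfderiv 𝓘(ℝ, E') 𝓘(ℝ, E) f u))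
    {e : OpenPartialHomeomorph M E} (he : e ∈ IsManifold.maximalAtlas 𝓘(ℝ, E) ∞ M)
    (hline : IsProjectiveChart L e)
    {ψ : OpenPartialHomeomorph N E'} (hψ : ψ ∈ IsManifold.maximalAtlas 𝓘(ℝ, E') ∞ N)
    (hconn : IsPreconnected ψ.target) (hmem : ∀ x ∈ ψ.target, f (ψ.symm x) ∈ e.source)
    {P : E →L[ℝ] E'} (hP : ∀ x ∈ ψ.target, P (e (f (ψ.symm x))) = x) :
    ∀ x ∈ ψ.target, ∀ x' ∈ ψ.target, fderiv ℝ (fun x => e (f (ψ.symm x))) x =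
      fderiv ℝ (fun x => e (f (ψ.symm x))) x' := by
  set Φ : E' → E := fun x => e (f (ψ.symm x)) with hΦdef
  have hΦ : ∀ x ∈ ψ.target, ContDiffAt ℝ 2 Φ x := fun x hx =>
    (contDiffAt_chart hf hψ he hx (hmem x hx)).of_le ENat.LEInfty.out
  have hdiag : ∀ x ∈ ψ.target, ∀ y, fderiv ℝ (fderiv ℝ Φ) x y y = 0 := by
    intro x hx y
    rcases eq_or_ne y 0 with rfl | hy
    · simp
    obtain ⟨γ, ε, hε, hγ, hγ0, hγ1, hg⟩ := (hL.induced hf hf').exists_geodesic hψ hx hy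
    have h0 : (0 : ℝ) ∈ Ioo (-ε) ε := ⟨by linarith, hε⟩
    have hG := hgeo _ _ hg
    have hs : f (ψ.symm (γ 0)) ∈ e.source := by rw [hγ0]; exact hmem x hx
    obtain ⟨r, hr⟩ := (hline.eulerLagrangeAt_iff hL he
      (hG.smooth.contMDiffAt (hG.isOpen.mem_nhds h0)) (hG.regular 0 h0) hs).mp
      (hG.eulerLagrange 0 h0 e he hs)
    have hγ2 : ContDiffAt ℝ 2 γ 0 := hγ.of_le ENat.LEInfty.out
    have hΦ0 : ContDiffAt ℝ 2 Φ (γ 0) := by rw [hγ0]; exact hΦ x hx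
    have hPD : ∀ v, P (fderiv ℝ Φ x v) = v := fun v => by
      have h1 : (fun x => P (Φ x)) =ᶠ[𝓝 x] fun x => x := by
        filter_upwards [ψ.open_target.mem_nhds hx] with x' hx'
        exact hP x' hx'
      have h2 : HasFDerivAt (fun x => P (Φ x)) (P.comp (fderiv ℝ Φ x)) x :=
        P.hasFDerivAt.comp x ((hΦ x hx).differentiableAt two_ne_zero).hasFDerivAt
      exact congrArg (fun A : E' →L[ℝ] E' => A v)
        (h2.unique ((hasFDerivAt_id x).congr_of_eventuallyEq h1))
    have hPc : ∀ᶠ s in 𝓝 (0 : ℝ), P (Φ (γ s)) = γ s := by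
      filter_upwards [hγ.continuousAt.eventually
        (ψ.open_target.mem_nhds (by rw [hγ0]; exact hx))] with s hs
      exact hP _ hs
    have hcc : ContDiffAt ℝ 2 (fun s => Φ (γ s)) 0 := hΦ0.comp (0 : ℝ) hγ2
    -- `P` carries the velocity and the acceleration of `Φ ∘ γ` to those of `γ`
    have hPc1 : (fun s => P (deriv (fun s => Φ (γ s)) s)) =ᶠ[𝓝 0] deriv γ := by
      filter_upwards [hPc.eventually_nhds, hcc.eventually_hasDerivAt] with s h1 h2
      have h3 : (fun s => P (Φ (γ s))) =ᶠ[𝓝 s] γ := h1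
      rw [← h3.deriv_eq]
      exact (P.hasFDerivAt.comp_hasDerivAt s h2).deriv.symm
    have hPc2 : P (deriv (deriv fun s => Φ (γ s)) 0) = deriv (deriv γ) 0 := by
      rw [← hPc1.deriv_eq]
      exact (P.hasFDerivAt.comp_hasDerivAt (0 : ℝ) hcc.hasDerivAt_deriv).deriv.symm
    have hrγ : deriv (deriv γ) 0 = r • y := by
      rw [← hPc2, ← hγ1, ← hPc1.self_of_nhds, ← map_smul]
      exact congrArg P hr
    have h1 := deriv_deriv_comp_curve hΦ0 hγ2
    have h2 := (deriv_comp_curve hΦ0 hγ2).self_of_nhds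
    simp only [hγ0, hγ1] at h2
    have h3 : deriv (deriv fun s => Φ (γ s)) 0 = r • deriv (fun s => Φ (γ s)) 0 := hr
    rw [h1, h2, hrγ, hγ1, hγ0, map_smul] at h3
    simpa using h3
  have hzero : EqOn (fderiv ℝ (fderiv ℝ Φ)) 0 ψ.target := by
    intro x hx
    ext u v
    have hsymm : fderiv ℝ (fderiv ℝ Φ) x u v = fderiv ℝ (fderiv ℝ Φ) x v u :=
      ((hΦ x hx).isSymmSndFDerivAt (by simp)) u v
    have h1 := hdiag x hx (u + v)
    simp only [map_add, add_apply, hdiag x hx u, hdiag x hx v, zero_add, add_zero] at h1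
    rw [hsymm, ← two_smul ℝ] at h1
    have h2 := (smul_eq_zero.mp h1).resolve_left two_ne_zero
    rw [hsymm, h2]
    rfl
  intro x hx x' hx'
  exact ψ.open_target.is_const_of_fderiv_eq_zero hconn
    (fun z hz => (hΦ z hz).hasFDerivAt_fderiv.differentiableAt.differentiableWithinAt) hzero hx hx'

/-- If the coordinate expression of `f` has constant derivative, it maps straight lines to straight
lines, so that straight lines are extremals of the induced metric if they are extremals of the
metric. -/
theorem IsProjectiveChart.induced {f : N → M} {L : ∀ x : M, TangentSpace 𝓘(ℝ, E) x → ℝ}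
    {e : OpenPartialHomeomorph M E} (hline : IsProjectiveChart L e) (hL : IsFinsler L)
    (hf : ContMDiff 𝓘(ℝ, E') 𝓘(ℝ, E) ∞ f)
    (hf' : ∀ u, Injective (mfderiv 𝓘(ℝ, E') 𝓘(ℝ, E) f u))
    (he : e ∈ IsManifold.maximalAtlas 𝓘(ℝ, E) ∞ M)
    {ψ : OpenPartialHomeomorph N E'} (hψ : ψ ∈ IsManifold.maximalAtlas 𝓘(ℝ, E') ∞ N)
    (hmem : ∀ x ∈ ψ.target, f (ψ.symm x) ∈ e.source)
    (hconst : ∀ x ∈ ψ.target, ∀ x' ∈ ψ.target, fderiv ℝ (fun x => e (f (ψ.symm x))) x =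
      fderiv ℝ (fun x => e (f (ψ.symm x))) x') :
    IsProjectiveChart (E := E') (Finsler.induced (E' := E') f L) ψ := by
  intro x hx y hy w
  have hx0 : x + (0 : ℝ) • y ∈ ψ.target := by simpa using hx
  have hl : ContDiff ℝ ∞ fun s : ℝ => x + s • y := by fun_prop
  have hΦ := (contDiffAt_chart hf hψ he hx0 (hmem _ hx0))
  have hΦ2 : ContDiffAt ℝ 2 (fun x => e (f (ψ.symm x))) (x + (0 : ℝ) • y) :=
    hΦ.of_le ENat.LEInfty.out
  have hl2 : ContDiffAt ℝ 2 (fun s : ℝ => x + s • y) 0 := by fun_prop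
  rw [eulerLagrange_induced hL hf hf' hψ he (γ := fun s : ℝ => x + s • y) hl.contDiffAt
    (by rwa [deriv_line]) hx0 (hmem _ hx0)]
  have hcomp : ContDiffAt ℝ 2 (fun s : ℝ => e (f (ψ.symm (x + s • y)))) 0 := by
    have h := ContDiffAt.comp (f := fun s : ℝ => x + s • y) (0 : ℝ) hΦ2 hl2
    exact h
  have h1 := (deriv_comp_curve (γ := fun s : ℝ => x + s • y) hΦ2 hl2).self_of_nhds
  have h2 := deriv_deriv_comp_curve (γ := fun s : ℝ => x + s • y) hΦ2 hl2
  have h3 : fderiv ℝ (fderiv ℝ fun x => e (f (ψ.symm x))) (x + (0 : ℝ) • y) = 0 := by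
    have : (fderiv ℝ fun x => e (f (ψ.symm x))) =ᶠ[𝓝 (x + (0 : ℝ) • y)]
        fun _ => fderiv ℝ (fun x => e (f (ψ.symm x))) (x + (0 : ℝ) • y) := by
      filter_upwards [ψ.open_target.mem_nhds hx0] with x' hx'
      exact hconst _ hx' _ hx0
    rw [this.fderiv_eq]
    simp
  have h4 : deriv (fun s : ℝ => e (f (ψ.symm (x + s • y)))) 0 ≠ 0 := by
    rw [h1, deriv_line]
    exact fun h => hy (fderiv_chart_injective hf hf' hψ he hx0 (hmem _ hx0)
      (h.trans (map_zero _).symm))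
  refine ((hL.isFinslerOn_coordExpr he).eulerLagrange_eq_zero_iff
    (c := fun s : ℝ => e (f (ψ.symm (x + s • y)))) hcomp
    (e.map_source (hmem _ hx0)) h4 (hline _ (e.map_source (hmem _ hx0)) _ h4)).mpr ⟨0, ?_⟩ _
  rw [h2, h3, deriv_line]
  simp

/-- A totally geodesic submanifold of a projectively flat Finsler space is projectively flat with
respect to the metric induced from any metric that is projectively related to the ambient one. -/
theorem IsProjectivelyFlat.induced_of_isProjectiveChange [FiniteDimensional ℝ E]
    [FiniteDimensional ℝ E'] {f : N → M} {L L₁ : ∀ x : M, TangentSpace 𝓘(ℝ, E) x → ℝ}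
    (hflat : IsProjectivelyFlat L)
    (hf : ContMDiff 𝓘(ℝ, E') 𝓘(ℝ, E) ∞ f)
    (hf' : ∀ u, Injective (mfderiv 𝓘(ℝ, E') 𝓘(ℝ, E) f u))
    (hgeo : IsTotallyGeodesic (E' := E') f L) (hL₁ : IsFinsler L₁) (hproj : IsProjectiveChange L L₁) :
    IsProjectivelyFlat (E := E') (Finsler.induced (E' := E') f L₁) := by
  obtain ⟨hL, L', ⟨hL', hmink⟩, hLL'⟩ := hflat
  have hL₁L' : IsProjectiveChange L₁ L' := fun c J => (hproj c J).symm.trans (hLL' c J)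
  have hL'L' : IsProjectiveChange L' L' := fun c J => Iff.rfl
  have key : ∀ p : N, ∃ ψ ∈ IsManifold.maximalAtlas 𝓘(ℝ, E') ∞ N, p ∈ ψ.source ∧
      (∀ x ∈ ψ.target, ∀ x' ∈ ψ.target, ∀ y : E',
        coordExpr (Finsler.induced (E' := E') f L') ψ x y =
          coordExpr (Finsler.induced (E' := E') f L') ψ x' y) ∧
      IsProjectiveChart (E := E') (Finsler.induced (E' := E') f L₁) ψ ∧
      IsProjectiveChart (E := E') (Finsler.induced (E' := E') f L') ψ := by
    intro p
    obtain ⟨e, he, hpe, hconst⟩ := hmink (f p)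
    obtain ⟨ψ, hψ, hpψ, hconn, hmem, P, hP⟩ := exists_graph_chart hf hf' p he hpe
    have hD := hgeo.fderiv_chart_eq hL hf hf' he (hLL'.isProjectiveChart hL' he hconst) hψ hconn
      hmem hP
    refine ⟨ψ, hψ, hpψ, fun x hx x' hx' y => ?_,
      (hL₁L'.isProjectiveChart hL' he hconst).induced hL₁ hf hf' he hψ hmem hD,
      (hL'L'.isProjectiveChart hL' he hconst).induced hL' hf hf' he hψ hmem hD⟩
    rw [coordExpr_induced L' hf hψ he hx (hmem x hx),
      coordExpr_induced L' hf hψ he hx' (hmem x' hx'), hD x hx x' hx']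
    exact hconst _ (e.map_source (hmem x hx)) _ (e.map_source (hmem x' hx')) _
  refine ⟨hL₁.induced hf hf', Finsler.induced (E' := E') f L', ⟨hL'.induced hf hf', fun p => ?_⟩,
    isProjectiveChange_of_charts (hL₁.induced hf hf') (hL'.induced hf hf') fun p => ?_⟩
  · obtain ⟨ψ, hψ, hp, h, -, -⟩ := key p
    exact ⟨ψ, hψ, hp, h⟩
  · obtain ⟨ψ, hψ, hp, -, h1, h2⟩ := key p
    exact ⟨ψ, hψ, hp, h1, h2⟩

end Flat

end Finsler

end

theorem theorem5p3 (n : ℕ) (hn : 3 < n)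
    {M : Type*} [TopologicalSpace M] [ChartedSpace (EuclideanSpace ℝ (Fin n)) M]
    [IsManifold (𝓡 n) ∞ M]
    {N : Type*} [TopologicalSpace N] [ChartedSpace (EuclideanSpace ℝ (Fin (n - 1))) N]
    [IsManifold (𝓡 (n - 1)) ∞ N]
    (f : N → M) (hf : ContMDiff (𝓡 (n - 1)) (𝓡 n) ∞ f)
    (hf' : ∀ u : N, Function.Injective (mfderiv (𝓡 (n - 1)) (𝓡 n) f u))
    (L : ∀ x : M, TangentSpace (𝓡 n) x → ℝ)
    (hflat : Finsler.IsProjectivelyFlat L)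
    (hgeo : Finsler.IsTotallyGeodesic (E' := EuclideanSpace ℝ (Fin (n - 1))) f L)
    (σ : M → ℝ) (hσ : ContMDiff (𝓡 n) 𝓘(ℝ, ℝ) ∞ σ)
    (β : ∀ x : M, TangentSpace (𝓡 n) x →L[ℝ] ℝ)
    (hβ : ContMDiff (𝓡 n).tangent 𝓘(ℝ, ℝ) ∞
      (fun v : TangentBundle (𝓡 n) M => β v.proj v.snd))
    (hLstar : Finsler.IsFinsler (Finsler.randersConformalChange σ β L))
    (hproj : Finsler.IsProjectiveChange L (Finsler.randersConformalChange σ β L)) :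
    Finsler.IsProjectivelyFlat (E := EuclideanSpace ℝ (Fin (n - 1)))
      (Finsler.induced (E' := EuclideanSpace ℝ (Fin (n - 1))) f (Finsler.randersConformalChange σ β L)) := by
  exact hflat.induced_of_isProjectiveChange hf hf' hgeo hLstar hproj
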